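/- **Theorem (Ambiguous $S$-class number formula).** Let $L/K$ be a finite cyclic extension of number fields with Galois group $G$, and let $S$ be a finite set of primes of $K$ containing all the infinite primes; write $S$ also for the set of primes of $L$ lying over primes in $S$. For $F\in\{K,L\}$ let $J_{F,S}$ be the group of fractional ideals of $F$ generated by the primes outside $S$; let $U_{F,S}$ (the $S$-units) and $P_{F,S}$ be the kernel and the image of the homomorphism $F^\times\to J_{F,S}$ that sends $\alpha$ to the principal ideal $(\alpha)$ with the primes in $S$ removed; and let $\mathrm{Cl}_{F,S}=J_{F,S}/P_{F,S}$. Put $h_{K,S}=|\mathrm{Cl}_{K,S}|$. Let $\mathrm{Am}(L/K,S)=\mathrm{Cl}_{L,S}^{G}$ be the group of ambiguous $S$-ideal classes, and let $\mathrm{Am}_{\mathrm{st}}(L/K,S)$ be its subgroup of strongly ambiguous classes, i.e. of the classes that contain an $S$-ideal $\mathfrak a\in J_{L,S}$ with $\sigma(\mathfrak a)=\mathfrak a$ for all $\sigma\in G$. Let $\mathrm{Nm}$ denote the norm from $L$ to $K$. Then these groups are finite, only finitely many primes of $K$ ramify in $L$, and $$|\mathrm{Am}(L/K,S)|=\frac{h_{K,S}\;e_{L/K,S}}{[L:K]\,[U_{K,S}:U_{K,S}\cap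 \mathrm{Nm}(L^\times)]},\qquad |\mathrm{Am}_{\mathrm{st}}(L/K,S)|=\frac{h_{K,S}\;e_{L/K,S}}{[L:K]\,[U_{K,S}:\mathrm{Nm}(U_{L,S})]},$$ where $$e_{L/K,S}=\prod_{v\in S}n_v\;\prod_{v\notin S}e(v),$$ $n_v=[L_w:K_v]$ is the degree of the extension of completions at a prime $w$ of $L$ over $v$, and $e(v)$ is the ramification index of $v$ in $L$ (neither depends on the choice of $w$). -/

import Mathlib

open NumberField IsDedekindDomain
open scoped nonZeroDivisors

set_option linter.unusedSectionVars false

noncomputable section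

namespace SClassGroup

/-! ### `S`-ideals and `S`-ideal classes of one number field

Only the finite primes of `S` matter for `S`-ideals and `S`-units; they form the set `T` below.
The group of `S`-units is Mathlib's `Set.unit`. -/

section OneField

variable (F : Type*) [Field F] [NumberField F] (T : Set (HeightOneSpectrum (𝓞 F)))

/-- The group `J_F` of all (invertible, that is, nonzero) fractional ideals of `F`. -/
abbrev IdealGroup : Type _ := (FractionalIdeal (𝓞 F)⁰ F)ˣ

/-- The group `J_{F,S}` of `S`-ideals: the fractional ideals generated by the primes outside `T`. -/
def sIdeals : Subgroup (IdealGroup F) :=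
  Subgroup.closure {I | ∃ w : HeightOneSpectrum (𝓞 F), w ∉ T ∧
    (I : FractionalIdeal (𝓞 F)⁰ F) = (w.asIdeal : FractionalIdeal (𝓞 F)⁰ F)}

/-- The image `P_{F,S}` of `Fˣ` in `J_{F,S}`, where `x` is sent to the principal fractional ideal
`(x)` with the primes of `T` removed: an `S`-ideal is in the image iff it equals `(x) * A` with
`x` in `Fˣ` and `A` a fractional ideal generated by the primes in `T`. -/
def principalSIdeals : Subgroup (sIdeals F T) :=
  ((toPrincipalIdeal (𝓞 F) F).range ⊔ sIdeals F Tᶜ).subgroupOf (sIdeals F T)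

/-- The `S`-ideal class group `Cl_{F,S} = J_{F,S} / P_{F,S}`. -/
abbrev SClass : Type _ := sIdeals F T ⧸ principalSIdeals F T

end OneField

section Extension

variable {K : Type*} [Field K] [NumberField K] (L : Type*) [Field L] [NumberField L] [Algebra K L]

/-- The finite primes of `L` that lie over a prime in `S`. -/
def primesAbove (S : Set (HeightOneSpectrum (𝓞 K))) : Set (HeightOneSpectrum (𝓞 L)) :=
  {w | w.under (𝓞 K) ∈ S}

variable {L}

/-! ### The Galois action on `S`-ideals and `S`-ideal classes -/

/-- The action `I ↦ σ(I)` of `σ ∈ Gal(L/K)` on the fractional ideals of `L`. -/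
def galIdeal (σ : Gal(L/K)) : IdealGroup L ≃* IdealGroup L :=
  Units.mapEquiv (FractionalIdeal.ringEquivOfRingEquiv L L
    (RingOfIntegers.mapRingEquiv (σ : L ≃+* L))).toMulEquiv

theorem mem_galIdeal (σ : Gal(L/K)) (I : IdealGroup L) (x : L) :
    x ∈ (galIdeal σ I : FractionalIdeal (𝓞 L)⁰ L) ↔
      ∃ y ∈ (I : FractionalIdeal (𝓞 L)⁰ L), σ y = x := by
  have key : ∀ y : L, IsFractionRing.ringEquivOfRingEquiv (K := L) (L := L)
      (RingOfIntegers.mapRingEquiv (σ : L ≃+* L)) y = σ y := by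
    intro y
    obtain ⟨a, b, hb, rfl⟩ := IsFractionRing.div_surjective (A := 𝓞 L) y
    simp [RingOfIntegers.mapRingEquiv_apply]
  have h : x ∈ (galIdeal σ I : FractionalIdeal (𝓞 L)⁰ L) ↔
      ∃ y ∈ (I : FractionalIdeal (𝓞 L)⁰ L), IsFractionRing.ringEquivOfRingEquiv (K := L) (L := L)
      (RingOfIntegers.mapRingEquiv (σ : L ≃+* L)) y = x := Iff.rfl
  simpa only [key] using h

theorem galIdeal_principal (σ : Gal(L/K)) (x : Lˣ) :
    galIdeal σ (toPrincipalIdeal (𝓞 L) L x) =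
      toPrincipalIdeal (𝓞 L) L (Units.map (σ : L →* L) x) := by
  apply Units.ext
  apply FractionalIdeal.ext
  intro y
  rw [mem_galIdeal]
  simp only [coe_toPrincipalIdeal, FractionalIdeal.mem_spanSingleton]
  constructor
  · rintro ⟨_, ⟨a, rfl⟩, rfl⟩
    exact ⟨RingOfIntegers.mapRingEquiv (σ : L ≃+* L) a, by
      simp [Algebra.smul_def, RingOfIntegers.mapRingEquiv_apply]⟩
  · rintro ⟨a, rfl⟩
    exact ⟨_, ⟨(RingOfIntegers.mapRingEquiv (σ : L ≃+* L)).symm a, rfl⟩, by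
      simp [Algebra.smul_def, RingOfIntegers.mapRingEquiv_symm_apply]⟩

theorem under_map_gal (σ : Gal(L/K)) (I : Ideal (𝓞 L)) :
    (I.map (RingOfIntegers.mapRingEquiv (σ : L ≃+* L))).under (𝓞 K) = I.under (𝓞 K) := by
  have hf : ∀ a : 𝓞 K, (RingOfIntegers.mapRingEquiv (σ : L ≃+* L)).symm
      (algebraMap (𝓞 K) (𝓞 L) a) = algebraMap (𝓞 K) (𝓞 L) a := by
    intro a
    rw [RingEquiv.symm_apply_eq]
    apply RingOfIntegers.ext
    rw [RingOfIntegers.mapRingEquiv_apply]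
    exact (σ.commutes (a : K)).symm
  ext a
  have h : I.map (RingOfIntegers.mapRingEquiv (σ : L ≃+* L)) =
      I.comap (RingOfIntegers.mapRingEquiv (σ : L ≃+* L)).symm := Ideal.map_comap_of_equiv _
  simp only [Ideal.under_def, Ideal.mem_comap, h, hf]

theorem galIdeal_mem_sIdeals (S : Set (HeightOneSpectrum (𝓞 K))) (σ : Gal(L/K))
    {I : IdealGroup L} (hI : I ∈ sIdeals L (primesAbove L S)) :
    galIdeal σ I ∈ sIdeals L (primesAbove L S) := by
  induction hI using Subgroup.closure_induction with
  | one => simp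
  | mul x y _ _ hx hy => simpa using mul_mem hx hy
  | inv x _ hx => simpa using hx
  | mem I hI =>
    obtain ⟨w, hw, hIw⟩ := hI
    let f := RingOfIntegers.mapRingEquiv (σ : L ≃+* L)
    let w' : HeightOneSpectrum (𝓞 L) :=
      { asIdeal := w.asIdeal.map f
        isPrime := Ideal.map_isPrime_of_equiv f
        ne_bot := by
          have := w.ne_bot
          rwa [Ne, Ideal.map_eq_bot_iff_of_injective f.injective] }
    have hunder : w'.under (𝓞 K) = w.under (𝓞 K) :=
      HeightOneSpectrum.ext (under_map_gal σ w.asIdeal)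
    refine Subgroup.subset_closure ⟨w', ?_, ?_⟩
    · simpa only [primesAbove, Set.mem_ofPred_eq, hunder] using hw
    · apply FractionalIdeal.ext
      intro x
      rw [mem_galIdeal, hIw]
      simp only [FractionalIdeal.mem_coeIdeal]
      constructor
      · rintro ⟨_, ⟨a, ha, rfl⟩, rfl⟩
        exact ⟨f a, Ideal.mem_map_of_mem f ha, RingOfIntegers.mapRingEquiv_apply _ a⟩
      · rintro ⟨b, hb, rfl⟩
        obtain ⟨a, ha, rfl⟩ := (Ideal.mem_map_of_equiv f b).1 hb
        exact ⟨_, ⟨a, ha, rfl⟩, (RingOfIntegers.mapRingEquiv_apply (σ : L ≃+* L) a).symm⟩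

theorem galIdeal_mem_principal_sup (S : Set (HeightOneSpectrum (𝓞 K))) (σ : Gal(L/K))
    {I : IdealGroup L}
    (hI : I ∈ (toPrincipalIdeal (𝓞 L) L).range ⊔ sIdeals L (primesAbove L S)ᶜ) :
    galIdeal σ I ∈ (toPrincipalIdeal (𝓞 L) L).range ⊔ sIdeals L (primesAbove L S)ᶜ := by
  obtain ⟨_, ⟨x, rfl⟩, A, hA, rfl⟩ := Subgroup.mem_sup.1 hI
  rw [map_mul, galIdeal_principal]
  exact Subgroup.mul_mem_sup ⟨_, rfl⟩ (galIdeal_mem_sIdeals Sᶜ σ hA)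

/-- The action of `σ ∈ Gal(L/K)` on `J_{L,S}`. -/
def galSIdeal (S : Set (HeightOneSpectrum (𝓞 K))) (σ : Gal(L/K)) :
    sIdeals L (primesAbove L S) →* sIdeals L (primesAbove L S) :=
  ((galIdeal σ).toMonoidHom.comp (sIdeals L (primesAbove L S)).subtype).codRestrict _
    fun I => galIdeal_mem_sIdeals S σ I.2

/-- The action of `σ ∈ Gal(L/K)` on `Cl_{L,S}`, sending the class of `I` to the class of `σ(I)`. -/
def galSClass (S : Set (HeightOneSpectrum (𝓞 K))) (σ : Gal(L/K)) :
    SClass L (primesAbove L S) →* SClass L (primesAbove L S) :=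
  QuotientGroup.map _ _ (galSIdeal S σ) fun _ hI => galIdeal_mem_principal_sup S σ hI

variable (L)

/-- The group `Am(L/K,S) = Cl_{L,S}^G` of ambiguous `S`-ideal classes. -/
def ambiguous (S : Set (HeightOneSpectrum (𝓞 K))) : Subgroup (SClass L (primesAbove L S)) where
  carrier := {c | ∀ σ : Gal(L/K), galSClass S σ c = c}
  one_mem' σ := map_one _
  mul_mem' hc hd σ := by rw [map_mul, hc σ, hd σ]
  inv_mem' hc σ := by rw [map_inv, hc σ]

/-- The group `J_{L,S}^G` of `S`-ideals of `L` fixed by the Galois group. -/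
def invariantSIdeals (S : Set (HeightOneSpectrum (𝓞 K))) :
    Subgroup (sIdeals L (primesAbove L S)) where
  carrier := {I | ∀ σ : Gal(L/K), galSIdeal S σ I = I}
  one_mem' σ := map_one _
  mul_mem' hc hd σ := by rw [map_mul, hc σ, hd σ]
  inv_mem' hc σ := by rw [map_inv, hc σ]

/-- The group `Am_st(L/K,S)` of strongly ambiguous `S`-ideal classes: the classes that contain a
Galois-invariant `S`-ideal. -/
def stronglyAmbiguous (S : Set (HeightOneSpectrum (𝓞 K))) :
    Subgroup (SClass L (primesAbove L S)) :=
  (invariantSIdeals L S).map (QuotientGroup.mk' _)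

/-! ### Norms -/

variable (K) in
/-- The norm homomorphism `Lˣ → Kˣ`. -/
def normUnits : Lˣ →* Kˣ := Units.map (Algebra.norm K)

/-! ### Local degrees and ramification -/

/-- The natural map `K_v → L_w` of completions for finite primes `w ∣ v`: the continuous extension
of the inclusion of `K` in `L`. -/
def completionMap (v : HeightOneSpectrum (𝓞 K)) (w : HeightOneSpectrum (𝓞 L))
    [w.asIdeal.LiesOver v.asIdeal] : v.adicCompletion K →+* w.adicCompletion L :=
  ((HeightOneSpectrum.adicCompletion.equiv L w).symm.toRingHom.comp
    (UniformSpace.Completion.mapRingHom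
      (algebraMap (WithVal (v.valuation K)) (WithVal (w.valuation L)))
      (HeightOneSpectrum.uniformContinuous_algebraMap_liesOver K L v w).continuous)).comp
    (HeightOneSpectrum.adicCompletion.equiv K v).toRingHom

theorem exists_liesOver (v : HeightOneSpectrum (𝓞 K)) :
    ∃ w : HeightOneSpectrum (𝓞 L), w.asIdeal.LiesOver v.asIdeal := by
  have := v.isMaximal
  obtain ⟨P, hP, h⟩ := Ideal.exists_maximal_ideal_liesOver_of_isIntegral (S := 𝓞 L) v.asIdeal
  exact ⟨⟨P, hP.isPrime, Ideal.ne_bot_of_liesOver_of_ne_bot v.ne_bot P⟩, h⟩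

theorem exists_liesOver_infinite (v : InfinitePlace K) :
    ∃ w : InfinitePlace L, w.LiesOver v := by
  obtain ⟨w, rfl⟩ := InfinitePlace.comap_surjective (K := L) v
  exact ⟨w, ⟨rfl⟩⟩

/-- The local degree `n_v = [L_w : K_v]` at a finite prime `v`, for a prime `w ∣ v` of `L`. It does
not depend on the choice of `w` when `L/K` is Galois. -/
def localDegree (v : HeightOneSpectrum (𝓞 K)) : ℕ :=
  letI w := (exists_liesOver L v).choose
  haveI : w.asIdeal.LiesOver v.asIdeal := (exists_liesOver L v).choose_spec
  letI := (completionMap L v w).toAlgebra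
  Module.finrank (v.adicCompletion K) (w.adicCompletion L)

open scoped NumberField.LiesOver in
/-- The local degree `n_v = [L_w : K_v]` at an infinite prime `v`, for a prime `w ∣ v` of `L`. It
does not depend on the choice of `w` when `L/K` is Galois. -/
def localDegreeInfinite (v : InfinitePlace K) : ℕ :=
  letI w := (exists_liesOver_infinite L v).choose
  haveI : w.LiesOver v := (exists_liesOver_infinite L v).choose_spec
  Module.finrank v.Completion w.Completion

/-- The number `e_{L/K,S}`: the product of the local degrees `n_v` over `v ∈ S`, where `S` consists
of the finite primes in the given set and of all infinite primes, times the product of the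
ramification indices `e(v)` over the primes `v ∉ S`. -/
def localFactor (S : Finset (HeightOneSpectrum (𝓞 K))) : ℕ :=
  ((∏ v ∈ S, localDegree L v) * ∏ v : InfinitePlace K, localDegreeInfinite L v) *
    ∏ᶠ (v : HeightOneSpectrum (𝓞 K)) (_ : v ∉ S), v.asIdeal.ramificationIdxIn (𝓞 L)

end Extension

end SClassGroup

end

open SClassGroup

/-! Write `X = Lˣ`, `J` for the free abelian group on the primes of `L` outside `S`, `val : X → J`
for the valuations (`ordUnit`), `P = val X`, and `U = ker val` for the `S`-units. Let `s` generate
`G`, and let `d = s - 1` (`diffHom`) and `n = ∑ σ` (`normHom`), in additive notation. Both `X` and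
`J` satisfy `ker n = im d`: the first by Hilbert 90, the second because `J` is a permutation module.

The strongly ambiguous classes are `J^G / (P ∩ J^G)` and the ambiguous ones are `d⁻¹(P) / P`. Put
`h₁ = [U ∩ ker n : dU]`. Three index computations carry the proof.

Strongly ambiguous classes (`card_stronglyAmbiguous_mul`). `[J^G : val Kˣ] = h_K ∏ e(v)`, since the
ideals of `K` lie between the two groups, and `[P ∩ J^G : val Kˣ] = h₁` by a diagram chase. Hence
`h₁ |Am_st| = h_K ∏ e(v)`.

Ambiguous versus strongly ambiguous (`card_ambiguous_eq_mul`). `|Am| / |Am_st| = [d⁻¹(P) : P · J^G]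
= [U ∩ nX : nU]`, by a second chase.

Herbrand quotient of `U` (`herbrand_sUnits`). `[U_K : nU] [L:K] = h₁ ∏ n_v`, because `U × ℤ`
contains with finite index the permutation module on the places of `L` over `S`, whose stabilizers
have order `n_v` (`finrank_adicCompletion` at the finite places).

Eliminating `h₁` gives the formula for `Am_st`; splitting `[U_K : nU]` at `U_K ∩ nX` then gives the
one for `Am`. All indices are `relIndex`, which is `0` when infinite, so nonvanishing is tracked
throughout. -/

noncomputable section

namespace SClassGroup

/-! ### Index calculus and invariance of the Herbrand quotient under finite index. -/

section IndexCalculus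

variable {A B : Type*} [CommGroup A] [CommGroup B]

/-- Insert `R · (W ∩ ker f)` between `R` and `W`: the upper quotient is `f(W) / f(R)`, the lower one
is `(W ∩ ker f) / (R ∩ ker f)`. -/
theorem relIndex_eq_map_mul_ker (f : A →* B) {R W : Subgroup A} (h : R ≤ W) :
    R.relIndex W = (R.map f).relIndex (W.map f) * (R ⊓ f.ker).relIndex (W ⊓ f.ker) := by
  have h1 : R ≤ R ⊔ (W ⊓ f.ker) := le_sup_left
  have h2 : R ⊔ (W ⊓ f.ker) ≤ W := sup_le h inf_le_left
  rw [← Subgroup.relIndex_mul_relIndex _ _ _ h1 h2, Subgroup.relIndex_sup_left,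
    Subgroup.relIndex_map_map, mul_comm]
  congr 1
  · have e : W ⊔ f.ker = (R ⊔ f.ker) ⊔ W := by
      rw [sup_right_comm, sup_of_le_right h]
    rw [e, Subgroup.relIndex_sup_left, ← Subgroup.inf_relIndex_right (R ⊔ f.ker),
      sup_inf_assoc_of_le _ h, inf_comm W]
  · rw [← Subgroup.inf_relIndex_right, ← inf_assoc, inf_of_le_left h]

/-- If `f ∘ g` and `g ∘ f` vanish on `W` and `R ≤ W` has finite index, then the Herbrand quotients
of `R` and `W` agree. -/
theorem herbrand_eq_of_relIndex_ne_zero (f g : A →* A) (hfg : ∀ a, f (g a) = 1)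
    (hgf : ∀ a, g (f a) = 1) {R W : Subgroup A} (h : R ≤ W) (hRW : R.relIndex W ≠ 0)
    (hRf : R.map f ≤ R) (hRg : R.map g ≤ R) (hWf : W.map f ≤ W) (hWg : W.map g ≤ W)
    (h0 : (R.map g).relIndex (R ⊓ f.ker) ≠ 0) (h1 : (R.map f).relIndex (R ⊓ g.ker) ≠ 0) :
    (W.map g).relIndex (W ⊓ f.ker) ≠ 0 ∧ (W.map f).relIndex (W ⊓ g.ker) ≠ 0 ∧
    (W.map g).relIndex (W ⊓ f.ker) * (R.map f).relIndex (R ⊓ g.ker) =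
      (R.map g).relIndex (R ⊓ f.ker) * (W.map f).relIndex (W ⊓ g.ker) := by
  -- The index of `g(R)` in `W ∩ ker f`, computed through `g(W)` and through `R ∩ ker f`.
  have key : ∀ f g : A →* A, (∀ a, f (g a) = 1) → R.map g ≤ R → W.map g ≤ W →
      (R.map g).relIndex (W.map g) * (W.map g).relIndex (W ⊓ f.ker) =
      (R.map g).relIndex (R ⊓ f.ker) * (R ⊓ f.ker).relIndex (W ⊓ f.ker) := by
    intro f g hfg hR hW
    have hk : ∀ X : Subgroup A, X.map g ≤ f.ker := by
      rintro X _ ⟨a, -, rfl⟩; exact hfg a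
    rw [Subgroup.relIndex_mul_relIndex _ _ _ (Subgroup.map_mono h) (le_inf hW (hk _)),
      Subgroup.relIndex_mul_relIndex _ _ _ (le_inf hR (hk _)) (inf_le_inf_right _ h)]
  have ef := relIndex_eq_map_mul_ker f h
  have eg := relIndex_eq_map_mul_ker g h
  have k1 := key f g hfg hRg hWg
  have k2 := key g f hgf hRf hWf
  set a := (R.map g).relIndex (W.map g)
  set b := (R ⊓ f.ker).relIndex (W ⊓ f.ker)
  set c := (R.map f).relIndex (W.map f)
  set d := (R ⊓ g.ker).relIndex (W ⊓ g.ker)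
  rw [ef] at hRW
  have hc := left_ne_zero_of_mul hRW
  have hb := right_ne_zero_of_mul hRW
  have hrw2 := hRW
  rw [← ef, eg] at hrw2
  have ha := left_ne_zero_of_mul hrw2
  have hd := right_ne_zero_of_mul hrw2
  -- Both products are `[W : R]`, split along `f` and along `g`; this common factor is cancelled at
  -- the end.
  have e : c * b = a * d := by rw [← ef, ← eg]
  refine ⟨fun hz => ?_, fun hz => ?_, ?_⟩
  · rw [hz, mul_zero] at k1; exact (mul_ne_zero h0 hb) k1.symm
  · rw [hz, mul_zero] at k2; exact (mul_ne_zero h1 hd) k2.symm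
  · have : (c * b) ≠ 0 := hRW
    apply Nat.eq_of_mul_eq_mul_left (Nat.pos_of_ne_zero this)
    calc c * b * ((W.map g).relIndex (W ⊓ f.ker) * (R.map f).relIndex (R ⊓ g.ker))
        = (a * (W.map g).relIndex (W ⊓ f.ker)) * ((R.map f).relIndex (R ⊓ g.ker) * d) := by
          rw [e]; ring
      _ = c * b * ((R.map g).relIndex (R ⊓ f.ker) * (W.map f).relIndex (W ⊓ g.ker)) := by
          rw [k1, ← k2]; ring

theorem relIndex_prod (H H' : Subgroup A) (K K' : Subgroup B) :
    (H.prod K).relIndex (H'.prod K') = H.relIndex H' * K.relIndex K' := by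
  have e : ((H.prod K).subgroupOf (H'.prod K')) =
      ((H.subgroupOf H').prod (K.subgroupOf K')).comap (H'.prodEquiv K').toMonoidHom := by
    ext x; rfl
  rw [Subgroup.relIndex, e, Subgroup.index_comap_of_surjective _ (H'.prodEquiv K').surjective,
    Subgroup.index_prod]; rfl

end IndexCalculus

/-! ### The two diagram chases along `val : X → J`. -/

section Chevalley

variable {X J : Type*} [CommGroup X] [CommGroup J] (d n : X →* X) (d' n' : J →* J) (val : X →* J)

/-- This index is `|Am| / |Am_st|`. Applying `d'` loses nothing, since both groups contain `ker d'`;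
the images are `val (ker n)` and `val (n⁻¹ U)` with `U = ker val`, by exactness on `X` and `J`. Both
sides thus equal `[n⁻¹ U : U · ker n]`, read through `val` and through `n`. -/
theorem relIndex_sup_ker_comap_range (hd : ∀ x, val (d x) = d' (val x))
    (hn : ∀ x, val (n x) = n' (val x)) (hX : n.ker = d.range) (hJ : n'.ker = d'.range) :
    (val.range ⊔ d'.ker).relIndex (val.range.comap d') =
      (val.ker.map n).relIndex (val.ker ⊓ n.range) := by
  have hnd : ∀ a, n' (d' a) = 1 := fun a => by
    have : d' a ∈ n'.ker := hJ ▸ ⟨a, rfl⟩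
    exact this
  have e1 : val.range ⊔ d'.ker ≤ val.range.comap d' := by
    refine sup_le ?_ ?_
    · rintro _ ⟨x, rfl⟩; exact ⟨d x, hd x⟩
    · intro a ha
      rw [Subgroup.mem_comap, (MonoidHom.mem_ker).1 ha]; exact one_mem _
  have hk : d'.ker ≤ val.range.comap d' := le_sup_right.trans e1
  have s1 : (val.range ⊔ d'.ker).relIndex (val.range.comap d') =
      (val.range.map d').relIndex ((val.range.comap d').map d') := by
    rw [Subgroup.relIndex_map_map, sup_of_le_left hk]
  have e2 : val.range.map d' = (n.ker).map val := by
    rw [hX]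
    ext a; constructor
    · rintro ⟨_, ⟨x, rfl⟩, rfl⟩; exact ⟨d x, ⟨x, rfl⟩, hd x⟩
    · rintro ⟨_, ⟨x, rfl⟩, rfl⟩; exact ⟨val x, ⟨x, rfl⟩, (hd x).symm⟩
  have e3 : (val.range.comap d').map d' = (val.ker.comap n).map val := by
    ext a; constructor
    · rintro ⟨b, ⟨x, hx⟩, rfl⟩
      refine ⟨x, ?_, hx⟩
      change val (n x) = 1
      rw [hn, hx, hnd]
    · rintro ⟨x, hx, rfl⟩
      have : val x ∈ n'.ker := by
        change n' (val x) = 1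
        rw [← hn]; exact hx
      rw [hJ] at this
      obtain ⟨b, hb⟩ := this
      exact ⟨b, ⟨x, hb.symm⟩, hb⟩
  have e4 : val.ker ≤ val.ker.comap n := by
    intro x hx
    change val (n x) = 1
    rw [hn, (MonoidHom.mem_ker).1 hx, map_one]
  have e5 : (val.ker.comap n).map n = val.ker ⊓ n.range := by
    ext a; constructor
    · rintro ⟨b, hb, rfl⟩; exact ⟨hb, b, rfl⟩
    · rintro ⟨h, b, rfl⟩; exact ⟨b, h, rfl⟩
  rw [s1, e2, e3, Subgroup.relIndex_map_map, sup_of_le_left e4, ← e5, Subgroup.relIndex_map_map,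
    sup_comm, sup_of_le_left (a := val.ker.comap n)]
  intro x hx
  change val (n x) = 1
  rw [(MonoidHom.mem_ker).1 hx, map_one]

/-- Both sides equal `[d⁻¹ U : U · ker d]` with `U = ker val`, read through `val` on the left and
through `d` on the right. -/
theorem relIndex_map_ker_range_inf_ker (hd : ∀ x, val (d x) = d' (val x)) (hX : n.ker = d.range) :
    (d.ker.map val).relIndex (val.range ⊓ d'.ker) =
      (val.ker.map d).relIndex (val.ker ⊓ n.ker) := by
  have e1 : val.range ⊓ d'.ker = (val.ker.comap d).map val := by
    ext a; constructor
    · rintro ⟨⟨x, rfl⟩, h⟩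
      exact ⟨x, (hd x).trans h, rfl⟩
    · rintro ⟨x, hx, rfl⟩
      exact ⟨⟨x, rfl⟩, (hd x).symm.trans hx⟩
  have e4 : val.ker ≤ val.ker.comap d := by
    intro x hx
    change val (d x) = 1
    rw [hd, (MonoidHom.mem_ker).1 hx, map_one]
  have e6 : d.ker ≤ val.ker.comap d := by
    intro x hx
    change val (d x) = 1
    rw [(MonoidHom.mem_ker).1 hx, map_one]
  have e5 : (val.ker.comap d).map d = val.ker ⊓ n.ker := by
    rw [hX]
    ext a; constructor
    · rintro ⟨b, hb, rfl⟩; exact ⟨hb, b, rfl⟩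
    · rintro ⟨h, b, rfl⟩; exact ⟨b, h, rfl⟩
  rw [e1, Subgroup.relIndex_map_map, sup_of_le_left e4, ← e5, Subgroup.relIndex_map_map,
    sup_of_le_left e6, sup_comm]

end Chevalley

/-! ### The operators `s - 1` and norm for a finite group action. -/

section Cyclic

variable {A B G : Type*} [CommGroup A] [CommGroup B]

/-- The endomorphism `a ↦ s(a) / a`. -/
def diffHom (s : A →* A) : A →* A := s / MonoidHom.id A

theorem diffHom_apply (s : A →* A) (a : A) : diffHom s a = s a / a := rfl

theorem mem_ker_diffHom {s : A →* A} {a : A} : a ∈ (diffHom s).ker ↔ s a = a := by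
  rw [MonoidHom.mem_ker, diffHom_apply, div_eq_one]

/-- The endomorphism `a ↦ ∏ g, g(a)`. -/
def normHom [Fintype G] (ρ : G → A →* A) : A →* A := ∏ g, ρ g

theorem normHom_apply [Fintype G] (ρ : G → A →* A) (a : A) : normHom ρ a = ∏ g, ρ g a :=
  MonoidHom.finsetProd_apply _ _ _

theorem map_diffHom (φ : A →* B) {s : A →* A} {t : B →* B} (h : ∀ a, φ (s a) = t (φ a)) (a : A) :
    φ (diffHom s a) = diffHom t (φ a) := by
  simp [diffHom_apply, h]

theorem map_normHom [Fintype G] (φ : A →* B) {ρ : G → A →* A} {τ : G → B →* B}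
    (h : ∀ g a, φ (ρ g a) = τ g (φ a)) (a : A) : φ (normHom ρ a) = normHom τ (φ a) := by
  simp [normHom_apply, h]

variable [Group G] [Fintype G] {ρ : G → A →* A} (hρ : ∀ g h a, ρ (g * h) a = ρ g (ρ h a))

include hρ

theorem apply_normHom (g : G) (a : A) : ρ g (normHom ρ a) = normHom ρ a := by
  simp only [normHom_apply, map_prod, ← hρ]
  exact Fintype.prod_equiv (Equiv.mulLeft g) _ _ fun _ => rfl

theorem normHom_apply_apply (g : G) (a : A) : normHom ρ (ρ g a) = normHom ρ a := by
  simp only [normHom_apply, ← hρ]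
  exact Fintype.prod_equiv (Equiv.mulRight g) _ _ fun _ => rfl

theorem diffHom_normHom (g : G) (a : A) : diffHom (ρ g) (normHom ρ a) = 1 := by
  rw [diffHom_apply, apply_normHom hρ, div_self']

theorem normHom_diffHom (g : G) (a : A) : normHom ρ (diffHom (ρ g) a) = 1 := by
  rw [diffHom_apply, map_div, normHom_apply_apply hρ, div_self']

/-- As `G` is finite, `g = s ^ k` with `k` natural, and `s ^ k - 1` is a multiple of `s - 1` by
telescoping. -/
theorem apply_div_mem_range_diffHom (h1 : ∀ a, ρ 1 a = a) {s : G}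
    (hs : ∀ g, g ∈ Subgroup.zpowers s) (g : G) (a : A) : ρ g a / a ∈ (diffHom (ρ s)).range := by
  suffices H : ∀ k : ℕ, ∀ a, ρ (s ^ k) a / a ∈ (diffHom (ρ s)).range by
    obtain ⟨k, rfl⟩ := (mem_powers_iff_mem_zpowers (x := s)).2 (hs g)
    exact H k a
  intro k
  induction k with
  | zero => intro a; simp [h1]
  | succ k ih =>
    intro a
    have := mul_mem (ih (ρ s a)) (show ρ s a / a ∈ (diffHom (ρ s)).range from ⟨a, rfl⟩)
    rwa [div_mul_div_cancel, ← hρ, ← pow_succ] at this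

theorem apply_eq_of_mem_ker_diffHom (h1 : ∀ a, ρ 1 a = a) {s : G}
    (hs : ∀ g, g ∈ Subgroup.zpowers s) {a : A} (ha : a ∈ (diffHom (ρ s)).ker) (g : G) :
    ρ g a = a := by
  rw [mem_ker_diffHom] at ha
  obtain ⟨k, rfl⟩ := (mem_powers_iff_mem_zpowers (x := s)).2 (hs g)
  induction k with
  | zero => simp [h1]
  | succ k ih => simp only at ih ⊢; rw [pow_succ, hρ, ha, ih]

end Cyclic

/-! ### Cohomology of permutation modules. -/

section Permutation

variable {G Ω V : Type*} [Group G] [MulAction G Ω]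

/-- The action of `g` on the permutation module with basis `Ω`. -/
def permHom (g : G) : Multiplicative (Ω →₀ ℤ) →* Multiplicative (Ω →₀ ℤ) :=
  AddMonoidHom.toMultiplicative (Finsupp.mapDomain.addMonoidHom (g • · : Ω → Ω))

theorem permHom_ofAdd (g : G) (f : Ω →₀ ℤ) : permHom g (Multiplicative.ofAdd f) =
    Multiplicative.ofAdd (f.mapDomain (g • · : Ω → Ω)) := rfl

theorem permHom_apply (g : G) (f : Multiplicative (Ω →₀ ℤ)) (w : Ω) :
    (permHom g f).toAdd w = f.toAdd (g⁻¹ • w) := by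
  have : (permHom g f).toAdd (g • (g⁻¹ • w)) = f.toAdd (g⁻¹ • w) :=
    Finsupp.mapDomain_apply (MulAction.injective g) _ _
  rwa [smul_inv_smul] at this

theorem permHom_mul (g h : G) (f : Multiplicative (Ω →₀ ℤ)) :
    permHom (g * h) f = permHom g (permHom h f) := by
  apply Multiplicative.toAdd.injective
  ext w
  simp [permHom_apply, mul_smul]

theorem permHom_one (f : Multiplicative (Ω →₀ ℤ)) : permHom (1 : G) f = f := by
  apply Multiplicative.toAdd.injective
  ext w
  simp [permHom_apply]

theorem toAdd_normHom_apply [Fintype G] (f : Multiplicative (Ω →₀ ℤ)) (w : Ω) :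
    (normHom (fun g : G => permHom g) f).toAdd w = ∑ g : G, f.toAdd (g⁻¹ • w) := by
  rw [normHom_apply, toAdd_prod, Finsupp.finsetSum_apply]
  simp [permHom_apply]

variable {π : Ω → V} (hπ : Function.Surjective π) (hG : ∀ w w', π w = π w' ↔ ∃ g : G, g • w = w')

include hπ hG

/-- Modulo the image of `s - 1` every basis vector may be moved to the representative of its orbit.
A combination of representatives is killed by the norm only if it is zero, because the norm
multiplies its coefficient at a representative by the order of the stabilizer. -/
theorem ker_normHom_permHom [Fintype G] {s : G} (hs : ∀ g, g ∈ Subgroup.zpowers s) :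
    (normHom (fun g : G => permHom (Ω := Ω) g)).ker = (diffHom (permHom s)).range := by
  have hmul := permHom_mul (G := G) (Ω := Ω)
  refine le_antisymm ?_ ?_
  · classical
    intro f hf
    set r : Ω → Ω := fun w => Function.surjInv hπ (π w)
    have hr : ∀ w, π (r w) = π w := fun w => Function.surjInv_eq hπ _
    have hrπ : ∀ w w', π w = π w' → r w = r w' := fun w w' h => by simp only [r, h]
    have h1 : ∀ f : Ω →₀ ℤ, Multiplicative.ofAdd (f.mapDomain r) / Multiplicative.ofAdd f ∈
        (diffHom (permHom (Ω := Ω) s)).range := by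
      intro f
      induction f using Finsupp.induction_linear with
      | zero => simp
      | add f g hf hg =>
        have := mul_mem hf hg
        rwa [div_mul_div_comm, ← ofAdd_add, ← ofAdd_add, ← Finsupp.mapDomain_add] at this
      | single w c =>
        obtain ⟨g, hg⟩ := (hG w (r w)).1 (hr w).symm
        have := apply_div_mem_range_diffHom hmul permHom_one hs g
          (Multiplicative.ofAdd (Finsupp.single w c))
        rw [permHom_ofAdd, Finsupp.mapDomain_single, hg] at this
        rwa [Finsupp.mapDomain_single]
    have h2 : normHom (fun g : G => permHom (Ω := Ω) g)
        (Multiplicative.ofAdd (f.toAdd.mapDomain r)) = 1 := by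
      obtain ⟨y, hy⟩ := h1 f.toAdd
      rw [ofAdd_toAdd, eq_div_iff_mul_eq'] at hy
      rw [← hy, map_mul, normHom_diffHom hmul, one_mul]
      exact hf
    have h3 : f.toAdd.mapDomain r = 0 := by
      ext w
      by_cases hw : w ∈ Set.range r
      · obtain ⟨w, rfl⟩ := hw
        have h4 := toAdd_normHom_apply (G := G) (Multiplicative.ofAdd (f.toAdd.mapDomain r)) (r w)
        rw [h2] at h4
        -- The support meets each orbit only in its representative, so only the stabilizer
        -- contributes to the norm.
        have h5 : ∀ g : G, (f.toAdd.mapDomain r) (g⁻¹ • r w) =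
            if g⁻¹ • r w = r w then f.toAdd.mapDomain r (r w) else 0 := by
          intro g
          split_ifs with h
          · rw [h]
          · refine Finsupp.mapDomain_of_notMem_range _ _ ?_
            rintro ⟨w', hw'⟩
            apply h
            rw [← hw']
            refine hrπ _ _ ?_
            rw [← hr w', hw', ← hr w]
            exact ((hG _ _).2 ⟨g⁻¹, rfl⟩).symm
        simp only [toAdd_ofAdd, h5, Finset.sum_ite, Finset.sum_const_zero, add_zero,
          Finset.sum_const, nsmul_eq_mul] at h4
        rw [toAdd_one, Finsupp.zero_apply, zero_eq_mul] at h4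
        refine h4.resolve_left ?_
        refine Nat.cast_ne_zero.2 ?_
        exact Finset.card_ne_zero_of_mem (a := (1 : G)) (by simp)
      · exact Finsupp.mapDomain_of_notMem_range _ _ hw
    have := h1 f.toAdd
    rw [h3, ofAdd_zero, one_div, ofAdd_toAdd] at this
    exact inv_mem_iff.1 this
  · rintro _ ⟨f, rfl⟩
    exact normHom_diffHom hmul s f

omit hπ in
theorem finite_preimage_of_orbits [Finite G] {s : Set V} (hs : s.Finite) : (π ⁻¹' s).Finite := by
  refine hs.preimage' fun v _ => ?_
  rcases (π ⁻¹' {v}).eq_empty_or_nonempty with h | ⟨w, hw⟩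
  · rw [h]; exact Set.finite_empty
  · refine (Set.finite_range (fun g : G => g • w)).subset fun w' hw' => ?_
    obtain ⟨g, hg⟩ := (hG w w').1 (hw.trans hw'.symm)
    exact ⟨g, hg⟩

/-- The map that pulls functions on `V` back to `Ω` and multiplies them by `c`. -/
def inflate [Finite G] (c : V → ℕ) : Multiplicative (V →₀ ℤ) →* Multiplicative (Ω →₀ ℤ) :=
  AddMonoidHom.toMultiplicative
    { toFun b := Finsupp.ofSupportFinite (fun w => c (π w) * b (π w)) <| by
        refine (finite_preimage_of_orbits (G := G) hG b.support.finite_toSet).subset fun w hw => ?_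
        simp only [Function.mem_support] at hw
        exact Finsupp.mem_support_iff.2 (right_ne_zero_of_mul hw)
      map_zero' := by ext; simp [Finsupp.ofSupportFinite]
      map_add' a b := by ext; simp [Finsupp.ofSupportFinite, mul_add] }

omit hπ in
theorem inflate_apply [Finite G] (c : V → ℕ) (b : Multiplicative (V →₀ ℤ)) (w : Ω) :
    (inflate hG c b).toAdd w = c (π w) * b.toAdd (π w) := rfl

theorem inflate_injective [Finite G] {c : V → ℕ} (hc : ∀ v, c v ≠ 0) :
    Function.Injective (inflate hG c) := by
  intro a b h
  apply Multiplicative.toAdd.injective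
  ext v
  obtain ⟨w, rfl⟩ := hπ v
  have := congrArg (fun f : Multiplicative (Ω →₀ ℤ) => f.toAdd w) h
  simpa [inflate_apply, hc] using this

omit hπ in
theorem mem_ker_diffHom_permHom [Finite G] {s : G} (hs : ∀ g, g ∈ Subgroup.zpowers s)
    {f : Multiplicative (Ω →₀ ℤ)} :
    f ∈ (diffHom (permHom s)).ker ↔ ∀ w w', π w = π w' → f.toAdd w = f.toAdd w' := by
  have := Fintype.ofFinite G
  constructor
  · intro hf w w' hw
    obtain ⟨g, rfl⟩ := (hG w w').1 hw
    have := apply_eq_of_mem_ker_diffHom (permHom_mul (G := G) (Ω := Ω)) permHom_one hs hf g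
    conv_rhs => rw [← this, permHom_apply, inv_smul_smul]
  · intro h
    rw [mem_ker_diffHom]
    apply Multiplicative.toAdd.injective
    ext w
    rw [permHom_apply]
    exact h _ _ ((hG _ _).2 ⟨s, smul_inv_smul s w⟩)

theorem mem_range_inflate [Finite G] (c : V → ℕ) {f : Multiplicative (Ω →₀ ℤ)} :
    f ∈ (inflate hG c).range ↔ (∀ w w', π w = π w' → f.toAdd w = f.toAdd w') ∧
      ∀ w, (c (π w) : ℤ) ∣ f.toAdd w := by
  constructor
  · rintro ⟨b, rfl⟩
    refine ⟨fun w w' h => by simp only [inflate_apply, h], fun w => ⟨_, inflate_apply hG c b w⟩⟩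
  · rintro ⟨hf, h⟩
    refine ⟨Multiplicative.ofAdd (Finsupp.ofSupportFinite
      (fun v => f.toAdd (Function.surjInv hπ v) / c v) ?_), ?_⟩
    · refine (f.toAdd.support.finite_toSet.preimage
        (Function.injective_surjInv hπ).injOn).subset fun v hv => ?_
      simp only [Function.mem_support] at hv
      rw [Set.mem_preimage, Finset.mem_coe, Finsupp.mem_support_iff]
      intro h0
      rw [h0, Int.zero_ediv] at hv
      exact hv rfl
    · apply Multiplicative.toAdd.injective
      ext w
      rw [inflate_apply]
      change _ * (f.toAdd (Function.surjInv hπ (π w)) / (c (π w) : ℤ)) = _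
      rw [hf _ w (Function.surjInv_eq hπ _)]
      exact Int.mul_ediv_cancel' (h w)

/-- Invariant functions are functions on `V`, and the image consists of those divisible by `c`.
Reduction modulo `c v` at a point over each of the finitely many `v` with `c v ≠ 1` identifies the
quotient with `∏ ZMod (c v)`. -/
theorem relIndex_range_inflate [Finite G] {c : V → ℕ}
    (hfin : (Function.mulSupport c).Finite) {s : G} (hs : ∀ g, g ∈ Subgroup.zpowers s) :
    (inflate hG c).range.relIndex (diffHom (permHom (Ω := Ω) s)).ker = ∏ᶠ v, c v := by
  classical
  set F := (diffHom (permHom (Ω := Ω) s)).ker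
  let Θ : Multiplicative (Ω →₀ ℤ) →* Multiplicative (∀ v : hfin.toFinset, ZMod (c v)) :=
    AddMonoidHom.toMultiplicative (AddMonoidHom.pi fun v =>
      (Int.castAddHom _).comp (Finsupp.applyAddHom (Function.surjInv hπ v.1)))
  have hΘ : ∀ f v, (Θ f).toAdd v = ((f.toAdd (Function.surjInv hπ v.1) : ℤ) : ZMod (c v)) :=
    fun _ _ => rfl
  have e1 : (inflate hG c).range = Θ.ker ⊓ F := by
    ext f
    rw [Subgroup.mem_inf, mem_ker_diffHom_permHom hG hs, mem_range_inflate hπ hG, and_comm]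
    refine and_congr_left fun hf => ⟨fun h => ?_, fun h w => ?_⟩
    · rw [MonoidHom.mem_ker]
      apply Multiplicative.toAdd.injective
      ext v
      rw [hΘ, toAdd_one, Pi.zero_apply, ZMod.intCast_zmod_eq_zero_iff_dvd]
      simpa only [Function.surjInv_eq] using h (Function.surjInv hπ v.1)
    · by_cases hw : c (π w) = 1
      · simp [hw]
      · have := congrArg (fun x => x.toAdd ⟨π w, by simpa using hw⟩) (MonoidHom.mem_ker.1 h)
        simp only [hΘ, toAdd_one, Pi.zero_apply, ZMod.intCast_zmod_eq_zero_iff_dvd] at this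
        rwa [hf _ w (Function.surjInv_eq hπ _)] at this
  have e2 : F.map Θ = ⊤ := by
    refine top_le_iff.1 fun x _ => ?_
    choose b hb using fun v => ZMod.intCast_surjective (x.toAdd v)
    let b' : V →₀ ℤ := Finsupp.ofSupportFinite
      (fun v => if h : v ∈ hfin.toFinset then b ⟨v, h⟩ else 0) <|
        hfin.toFinset.finite_toSet.subset fun v hv => by
          by_contra h
          exact hv (dif_neg h)
    refine ⟨inflate hG (fun _ => 1) (Multiplicative.ofAdd b'), ?_, ?_⟩
    · refine (mem_ker_diffHom_permHom hG hs).2 fun w w' h => ?_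
      simp only [inflate_apply, h]
    · apply Multiplicative.toAdd.injective
      ext v
      rw [hΘ, inflate_apply, Function.surjInv_eq hπ, ← hb v]
      have : b' v.1 = b v := dif_pos v.2
      simp [this]
  rw [e1, Subgroup.inf_relIndex_right, Subgroup.relIndex_ker, e2,
    finprod_eq_prod_of_mulSupport_toFinset_subset _ hfin subset_rfl]
  simp only [Nat.card_congr Subgroup.topEquiv.toEquiv,
    Nat.card_congr (Multiplicative.toAdd (α := ∀ v : hfin.toFinset, ZMod (c v))),
    Nat.card_pi, Nat.card_zmod]
  exact Finset.prod_coe_sort hfin.toFinset c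

/-- The elements carrying `w` to `w'` form a two-sided translate of the stabilizer of the chosen
representative. -/
theorem card_smul_eq [Finite G] {w w' : Ω} (h : π w = π w') :
    Nat.card {g : G // g • w = w'} =
      Nat.card (MulAction.stabilizer G (Function.surjInv hπ (π w))) := by
  obtain ⟨a, ha⟩ := (hG (Function.surjInv hπ (π w)) w).1 (Function.surjInv_eq hπ _)
  obtain ⟨b, hb⟩ := (hG w' (Function.surjInv hπ (π w))).1 ((Function.surjInv_eq hπ _).trans h).symm
  refine Nat.card_congr (((Equiv.mulLeft b).trans (Equiv.mulRight a)).subtypeEquiv fun g => ?_)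
  simp only [Equiv.trans_apply, Equiv.coe_mulLeft, Equiv.coe_mulRight,
    MulAction.mem_stabilizer_iff, mul_smul, ha]
  constructor
  · intro h; rw [h, hb]
  · intro h; rw [← hb] at h; exact MulAction.injective b h

theorem normHom_permHom [Fintype G] (f : Ω →₀ ℤ) :
    normHom (fun g : G => permHom (Ω := Ω) g) (Multiplicative.ofAdd f) = inflate hG (fun v =>
      Nat.card (MulAction.stabilizer G (Function.surjInv hπ v)))
        (Multiplicative.ofAdd (f.mapDomain π)) := by
  classical
  induction f using Finsupp.induction_linear with
  | zero => simp
  | add f g hf hg => rw [Finsupp.mapDomain_add, ofAdd_add, ofAdd_add, map_mul, map_mul, hf, hg]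
  | single w k =>
    apply Multiplicative.toAdd.injective
    ext w'
    rw [toAdd_normHom_apply, inflate_apply]
    simp only [toAdd_ofAdd, Finsupp.mapDomain_single, Finsupp.single_apply]
    split_ifs with h
    · rw [← h, ← card_smul_eq hπ hG h, Finset.sum_ite, Finset.sum_const_zero, add_zero,
        Finset.sum_const, nsmul_eq_mul, Nat.card_eq_fintype_card, Fintype.card_subtype]
      simp only [eq_inv_smul_iff]
    · rw [mul_zero]
      refine Finset.sum_eq_zero fun g _ => if_neg fun hg => h ?_
      exact (hG _ _).2 ⟨g, by rw [hg, smul_inv_smul]⟩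

/-- With `relIndex_range_inflate`, this shows that invariants modulo norms have order the product of
the stabilizer orders, one per orbit. -/
theorem range_normHom_permHom [Fintype G] :
    (normHom (fun g : G => permHom (Ω := Ω) g)).range = (inflate hG fun v =>
      Nat.card (MulAction.stabilizer G (Function.surjInv hπ v))).range := by
  ext x
  constructor
  · rintro ⟨f, rfl⟩
    exact ⟨_, (normHom_permHom hπ hG f.toAdd).symm⟩
  · rintro ⟨b, rfl⟩
    obtain ⟨f, hf⟩ := Finsupp.mapDomain_surjective (M := ℤ) hπ b.toAdd
    refine ⟨Multiplicative.ofAdd f, ?_⟩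
    rw [normHom_permHom hπ hG, hf, ofAdd_toAdd]

end Permutation

/-! ### Ideals, principal ideals and units through valuations. -/

section Ord

variable (F : Type*) [Field F] [NumberField F]

variable {F} in
/-- A finite prime as an element of the group of fractional ideals. -/
def primeIdeal (v : HeightOneSpectrum (𝓞 F)) : IdealGroup F :=
  Units.mk0 (v.asIdeal : FractionalIdeal (𝓞 F)⁰ F) (FractionalIdeal.coeIdeal_ne_zero.2 v.ne_bot)

/-- The exponents of the primes outside `T` in the factorization of a fractional ideal. -/
def ordHom (T : Set (HeightOneSpectrum (𝓞 F))) :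
    IdealGroup F →* Multiplicative ({v // v ∉ T} →₀ ℤ) where
  toFun I := Multiplicative.ofAdd (Finsupp.ofSupportFinite
    (fun v => FractionalIdeal.count F v.1 (I : FractionalIdeal (𝓞 F)⁰ F)) <| by
      have h := FractionalIdeal.finite_factors (I : FractionalIdeal (𝓞 F)⁰ F)
      rw [Filter.eventually_cofinite] at h
      exact h.preimage Subtype.val_injective.injOn)
  map_one' := by
    apply Multiplicative.toAdd.injective
    ext v
    exact FractionalIdeal.count_one F v.1
  map_mul' I J := by
    apply Multiplicative.toAdd.injective
    ext v
    exact FractionalIdeal.count_mul F v.1 I.ne_zero J.ne_zero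

variable {F} {T : Set (HeightOneSpectrum (𝓞 F))}

theorem ordHom_apply (I : IdealGroup F) (v : {v // v ∉ T}) : (ordHom F T I).toAdd v =
    FractionalIdeal.count F v.1 (I : FractionalIdeal (𝓞 F)⁰ F) := rfl

theorem eq_prod_primeIdeal (I : IdealGroup F) : ∃ s : Finset (HeightOneSpectrum (𝓞 F)),
    (∀ v ∈ s, FractionalIdeal.count F v (I : FractionalIdeal (𝓞 F)⁰ F) ≠ 0) ∧
    I = ∏ v ∈ s, primeIdeal v ^ FractionalIdeal.count F v (I : FractionalIdeal (𝓞 F)⁰ F) := by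
  have h := FractionalIdeal.finite_factors (I : FractionalIdeal (𝓞 F)⁰ F)
  rw [Filter.eventually_cofinite] at h
  refine ⟨h.toFinset, by simp, ?_⟩
  apply Units.ext
  rw [Units.coe_prod]
  conv_lhs => rw [← FractionalIdeal.finprod_heightOneSpectrum_factorization' F I.ne_zero]
  rw [finprod_eq_prod_of_mulSupport_subset (s := h.toFinset)]
  · refine Finset.prod_congr rfl fun v _ => ?_
    rw [Units.val_zpow_eq_zpow_val]
    rfl
  · intro v hv
    rw [Set.Finite.coe_toFinset]
    intro h0
    rw [Function.mem_mulSupport, h0, zpow_zero] at hv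
    exact hv rfl

theorem primeIdeal_mem_sIdeals {v : HeightOneSpectrum (𝓞 F)} (hv : v ∉ T) :
    primeIdeal v ∈ sIdeals F T :=
  Subgroup.subset_closure ⟨v, hv, rfl⟩

theorem mem_sIdeals_iff {I : IdealGroup F} : I ∈ sIdeals F T ↔
    ∀ v ∈ T, FractionalIdeal.count F v (I : FractionalIdeal (𝓞 F)⁰ F) = 0 := by
  constructor
  · intro hI v hv
    induction hI using Subgroup.closure_induction with
    | one => exact FractionalIdeal.count_one F v
    | mul x y _ _ hx hy =>
      rw [Units.val_mul, FractionalIdeal.count_mul F v x.ne_zero y.ne_zero, hx, hy, add_zero]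
    | inv x _ hx => rw [Units.val_inv_eq_inv_val, FractionalIdeal.count_inv, hx, neg_zero]
    | mem I hI =>
      obtain ⟨w, hw, hIw⟩ := hI
      rw [hIw]
      exact FractionalIdeal.count_maximal_coprime F v fun h => hw (h ▸ hv)
  · intro h
    obtain ⟨s, hs, hI⟩ := eq_prod_primeIdeal I
    rw [hI]
    exact prod_mem fun v hv => zpow_mem (primeIdeal_mem_sIdeals fun hvT => hs v hv (h v hvT)) _

theorem ker_ordHom : (ordHom F T).ker = sIdeals F Tᶜ := by
  ext I
  rw [mem_sIdeals_iff, MonoidHom.mem_ker]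
  constructor
  · intro h v hv
    rw [← ordHom_apply I ⟨v, hv⟩, h]; rfl
  · intro h
    apply Multiplicative.toAdd.injective
    ext v
    exact h v.1 v.2

theorem map_ordHom_sIdeals : (sIdeals F T).map (ordHom F T) = ⊤ := by
  classical
  refine top_le_iff.1 fun f _ => ?_
  induction f using Multiplicative.rec with | _ f
  induction f using Finsupp.induction_linear with
  | zero => exact one_mem _
  | add f g hf hg => exact mul_mem (hf trivial) (hg trivial)
  | single v k =>
    refine ⟨primeIdeal v.1 ^ k, zpow_mem (primeIdeal_mem_sIdeals v.2) _, ?_⟩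
    apply Multiplicative.toAdd.injective
    ext w
    rw [ordHom_apply, Units.val_zpow_eq_zpow_val, FractionalIdeal.count_zpow]
    simp only [primeIdeal, Units.val_mk0, FractionalIdeal.count_maximal, toAdd_ofAdd,
      Finsupp.single_apply, Subtype.ext_iff]
    split_ifs <;> simp

theorem ordHom_surjective : Function.Surjective (ordHom F T) := by
  intro f
  have : f ∈ (sIdeals F T).map (ordHom F T) :=
    (map_ordHom_sIdeals (F := F) (T := T)).symm ▸ Subgroup.mem_top f
  obtain ⟨I, -, h⟩ := this
  exact ⟨I, h⟩

variable (F T) in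
/-- The group of `S`-ideals is free on the primes outside `S`. -/
def ordEquiv : sIdeals F T ≃* Multiplicative ({v // v ∉ T} →₀ ℤ) :=
  MulEquiv.ofBijective ((ordHom F T).comp (sIdeals F T).subtype) <| by
    constructor
    · rw [injective_iff_map_eq_one]
      intro I hI
      have h1 : (I : IdealGroup F) ∈ sIdeals F Tᶜ := ker_ordHom (T := T) ▸ hI
      obtain ⟨s, hs, h⟩ := eq_prod_primeIdeal (I : IdealGroup F)
      rw [Subtype.ext_iff, h]
      refine Finset.prod_eq_one fun v hv => absurd ?_ (hs v hv)
      by_cases hvT : v ∈ T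
      · exact mem_sIdeals_iff.1 I.2 v hvT
      · exact mem_sIdeals_iff.1 h1 v hvT
    · intro f
      have : f ∈ (sIdeals F T).map (ordHom F T) :=
        (map_ordHom_sIdeals (F := F) (T := T)).symm ▸ Subgroup.mem_top f
      obtain ⟨I, hI, h⟩ := this
      exact ⟨⟨I, hI⟩, h⟩

variable (F T) in
/-- The exponents of the primes outside `T` in the factorization of a principal ideal. -/
def ordUnit : Fˣ →* Multiplicative ({v // v ∉ T} →₀ ℤ) :=
  (ordHom F T).comp (toPrincipalIdeal (𝓞 F) F)

/-- The ideals supported on `T` are the kernel of `ordHom`, so allowing them as factors amounts to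
comparing valuations outside `T` only. The `S`-class group becomes the cokernel of `ordUnit`. -/
theorem principalSIdeals_eq_comap :
    principalSIdeals F T = (ordUnit F T).range.comap (ordEquiv F T).toMonoidHom := by
  ext I
  rw [principalSIdeals, Subgroup.mem_subgroupOf, Subgroup.mem_comap]
  change _ ↔ ordHom F T I ∈ _
  rw [← ker_ordHom, ordUnit, MonoidHom.range_comp, ← Subgroup.comap_map_eq, Subgroup.mem_comap]

theorem card_sClass : Nat.card (SClass F T) = (ordUnit F T).range.index := by
  rw [← Subgroup.index_eq_card, principalSIdeals_eq_comap]
  exact Subgroup.index_comap_of_surjective _ (ordEquiv F T).surjective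

variable (F T) in
-- The cokernel is a quotient of the ordinary class group, which is finite.
theorem index_range_ordUnit_ne_zero : (ordUnit F T).range.index ≠ 0 := by
  have h : (toPrincipalIdeal (𝓞 F) F).range.index ≠ 0 := by
    rw [Subgroup.index_ne_zero_iff_finite]
    exact Finite.of_equiv _ (ClassGroup.equiv (R := 𝓞 F) F).toEquiv
  rw [ordUnit, MonoidHom.range_comp]
  exact fun h0 => h (Nat.eq_zero_of_zero_dvd (h0 ▸ Subgroup.index_map_dvd _ ordHom_surjective))

theorem valuation_eq_exp_neg_count (v : HeightOneSpectrum (𝓞 F)) {x : F} (hx : x ≠ 0) :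
    v.valuation F x =
      WithZero.exp (-FractionalIdeal.count F v (FractionalIdeal.spanSingleton (𝓞 F)⁰ x)) := by
  classical
  obtain ⟨a, b, hb, rfl⟩ := IsFractionRing.div_surjective (A := 𝓞 F) x
  have hb0 : b ≠ 0 := nonZeroDivisors.ne_zero hb
  have ha0 : a ≠ 0 := by rintro rfl; simp at hx
  have key : FractionalIdeal.spanSingleton (𝓞 F)⁰ (algebraMap (𝓞 F) F a / algebraMap (𝓞 F) F b) =
      FractionalIdeal.spanSingleton (𝓞 F)⁰ (algebraMap (𝓞 F) F b)⁻¹ *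
        (Ideal.span {a} : Ideal (𝓞 F)) := by
    rw [FractionalIdeal.coeIdeal_span_singleton, FractionalIdeal.spanSingleton_mul_spanSingleton,
      div_eq_inv_mul]
  rw [FractionalIdeal.count_well_defined F v (FractionalIdeal.spanSingleton_ne_zero_iff.2 hx) key,
    map_div₀,
    HeightOneSpectrum.valuation_of_algebraMap, HeightOneSpectrum.valuation_of_algebraMap,
    HeightOneSpectrum.intValuation_if_neg _ ha0, HeightOneSpectrum.intValuation_if_neg _ hb0,
    ← WithZero.exp_sub]
  congr 1
  ring

theorem valuation_eq_exp_neg_ordUnit (x : Fˣ) (v : {v // v ∉ T}) :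
    v.1.valuation F (x : F) = WithZero.exp (-(ordUnit F T x).toAdd v) := by
  rw [valuation_eq_exp_neg_count v.1 x.ne_zero, ← coe_toPrincipalIdeal]; rfl

theorem ker_ordUnit : (ordUnit F T).ker = T.unit F := by
  ext x
  rw [MonoidHom.mem_ker]
  change _ ↔ ∀ v ∉ T, v.valuation F (x : F) = 1
  constructor
  · intro h v hv
    rw [valuation_eq_exp_neg_ordUnit x ⟨v, hv⟩, h]
    simp
  · intro h
    apply Multiplicative.toAdd.injective
    ext v
    have := h v.1 v.2
    rw [valuation_eq_exp_neg_ordUnit x v, ← WithZero.exp_zero, WithZero.exp_inj,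
      neg_eq_zero] at this
    exact this

end Ord

/-! ### Galois action on primes and valuations, and ramification. -/

section GaloisAction

variable {K : Type*} [Field K] [NumberField K] {L : Type*} [Field L] [NumberField L] [Algebra K L]

open scoped Pointwise in
/-- The action of the Galois group on the finite primes of `L`. -/
instance : MulAction Gal(L/K) (HeightOneSpectrum (𝓞 L)) where
  smul σ w :=
    { asIdeal := σ • w.asIdeal
      isPrime := inferInstance
      ne_bot := fun h => w.ne_bot <| by
        rw [smul_eq_iff_eq_inv_smul] at h
        rw [h, Ideal.pointwise_smul_def, Ideal.map_bot] }
  one_smul w := HeightOneSpectrum.ext (one_smul _ _)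
  mul_smul σ τ w := HeightOneSpectrum.ext (mul_smul _ _ _)

theorem galIdeal_primeIdeal (σ : Gal(L/K)) (w : HeightOneSpectrum (𝓞 L)) :
    galIdeal σ (primeIdeal w) = primeIdeal (σ • w) := by
  apply Units.ext
  apply FractionalIdeal.ext
  intro x
  rw [mem_galIdeal]
  simp only [primeIdeal, Units.val_mk0, FractionalIdeal.mem_coeIdeal]
  constructor
  · rintro ⟨_, ⟨a, ha, rfl⟩, rfl⟩
    exact ⟨σ • a, Ideal.smul_mem_pointwise_smul _ _ _ ha, rfl⟩
  · rintro ⟨b, hb, rfl⟩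
    refine ⟨_, ⟨σ⁻¹ • b, Ideal.mem_pointwise_smul_iff_inv_smul_mem.1 hb, rfl⟩, ?_⟩
    change ((σ • σ⁻¹ • b : 𝓞 L) : L) = b
    rw [smul_inv_smul]

/-- Both sides are homomorphisms in `I`, so it suffices to compare them on primes. -/
theorem count_galIdeal (σ : Gal(L/K)) (w : HeightOneSpectrum (𝓞 L)) (I : IdealGroup L) :
    FractionalIdeal.count L (σ • w) (galIdeal σ I : FractionalIdeal (𝓞 L)⁰ L) =
      FractionalIdeal.count L w (I : FractionalIdeal (𝓞 L)⁰ L) := by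
  classical
  let φ : HeightOneSpectrum (𝓞 L) → IdealGroup L →* Multiplicative ℤ := fun w =>
    { toFun := fun I => Multiplicative.ofAdd
        (FractionalIdeal.count L w (I : FractionalIdeal (𝓞 L)⁰ L))
      map_one' := congrArg _ (FractionalIdeal.count_one L w)
      map_mul' := fun I J => congrArg _ (FractionalIdeal.count_mul L w I.ne_zero J.ne_zero) }
  have h : ∀ w', φ (σ • w) (galIdeal σ (primeIdeal w')) = φ w (primeIdeal w') := by
    intro w'
    rw [galIdeal_primeIdeal]
    change Multiplicative.ofAdd (FractionalIdeal.count L (σ • w) ((σ • w').asIdeal :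
      FractionalIdeal (𝓞 L)⁰ L)) = Multiplicative.ofAdd (FractionalIdeal.count L w (w'.asIdeal :
      FractionalIdeal (𝓞 L)⁰ L))
    rw [FractionalIdeal.count_maximal, FractionalIdeal.count_maximal]
    simp only [smul_left_cancel_iff]
  suffices φ (σ • w) (galIdeal σ I) = φ w I from Multiplicative.ofAdd.injective this
  obtain ⟨s, -, hs⟩ := eq_prod_primeIdeal I
  rw [hs, map_prod, map_prod, map_prod]
  refine Finset.prod_congr rfl fun v _ => ?_
  rw [map_zpow, map_zpow, map_zpow, h]

theorem valuation_smul (σ : Gal(L/K)) (w : HeightOneSpectrum (𝓞 L)) (x : L) :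
    (σ • w).valuation L (σ x) = w.valuation L x := by
  rcases eq_or_ne x 0 with rfl | hx
  · simp
  · have h := count_galIdeal σ w (toPrincipalIdeal (𝓞 L) L (Units.mk0 x hx))
    rw [galIdeal_principal, coe_toPrincipalIdeal, coe_toPrincipalIdeal] at h
    rw [valuation_eq_exp_neg_count _ hx, valuation_eq_exp_neg_count _ (by simpa using hx)]
    congr 2

theorem under_smul (σ : Gal(L/K)) (w : HeightOneSpectrum (𝓞 L)) :
    (σ • w).under (𝓞 K) = w.under (𝓞 K) :=
  HeightOneSpectrum.ext (under_map_gal σ w.asIdeal)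

theorem under_eq_iff [IsGalois K L] (w w' : HeightOneSpectrum (𝓞 L)) :
    w.under (𝓞 K) = w'.under (𝓞 K) ↔ ∃ σ : Gal(L/K), σ • w = w' := by
  constructor
  · intro h
    obtain ⟨σ, hσ⟩ := Algebra.IsInvariant.exists_smul_of_under_eq (𝓞 K) (𝓞 L) Gal(L/K)
      w.asIdeal w'.asIdeal (congrArg HeightOneSpectrum.asIdeal h)
    exact ⟨σ, HeightOneSpectrum.ext hσ.symm⟩
  · rintro ⟨σ, rfl⟩
    exact (under_smul σ w).symm

instance liesOver_under (w : HeightOneSpectrum (𝓞 L)) :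
    w.asIdeal.LiesOver (w.under (𝓞 K)).asIdeal := ⟨rfl⟩

variable (S : Set (HeightOneSpectrum (𝓞 K)))

instance : MulAction Gal(L/K) {w // w ∉ primesAbove L S} where
  smul σ w := ⟨σ • w.1, fun h => w.2 <| by
    change (σ • w.1).under (𝓞 K) ∈ S at h
    rwa [under_smul] at h⟩
  one_smul w := Subtype.ext (one_smul _ _)
  mul_smul σ τ w := Subtype.ext (mul_smul _ _ _)

theorem coe_smul_notMem (σ : Gal(L/K)) (w : {w // w ∉ primesAbove L S}) :
    ((σ • w : {w // w ∉ primesAbove L S}) : HeightOneSpectrum (𝓞 L)) = σ • w.1 := rfl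

variable (L) in
/-- The prime of `K` below a prime of `L` that does not lie over a prime in `S`. -/
def primeBelow (w : {w // w ∉ primesAbove L S}) : {v // v ∉ S} := ⟨w.1.under (𝓞 K), w.2⟩

theorem primeBelow_surjective : Function.Surjective (primeBelow L S) := by
  rintro ⟨v, hv⟩
  obtain ⟨w, hw⟩ := exists_liesOver L v
  have : w.under (𝓞 K) = v := HeightOneSpectrum.ext hw.over.symm
  exact ⟨⟨w, fun h => hv (this ▸ h)⟩, Subtype.ext this⟩

theorem primeBelow_eq_iff [IsGalois K L] (w w' : {w // w ∉ primesAbove L S}) :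
    primeBelow L S w = primeBelow L S w' ↔ ∃ σ : Gal(L/K), σ • w = w' := by
  rw [Subtype.ext_iff, primeBelow, primeBelow, under_eq_iff]
  simp only [Subtype.ext_iff, coe_smul_notMem]

theorem ordHom_galIdeal (σ : Gal(L/K)) (I : IdealGroup L) :
    ordHom L (primesAbove L S) (galIdeal σ I) = permHom σ (ordHom L (primesAbove L S) I) := by
  apply Multiplicative.toAdd.injective
  ext w
  rw [permHom_apply, ordHom_apply, ordHom_apply, coe_smul_notMem, ← count_galIdeal σ (σ⁻¹ • w.1),
    smul_inv_smul]

theorem ordUnit_map (σ : Gal(L/K)) (x : Lˣ) :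
    ordUnit L (primesAbove L S) (Units.map (σ : L →* L) x) =
      permHom σ (ordUnit L (primesAbove L S) x) := by
  rw [ordUnit, MonoidHom.comp_apply, ← galIdeal_principal, ordHom_galIdeal]; rfl

theorem ramificationIdxIn_eq [IsGalois K L] (w : HeightOneSpectrum (𝓞 L)) :
    (w.under (𝓞 K)).asIdeal.ramificationIdxIn (𝓞 L) =
      (w.under (𝓞 K)).asIdeal.ramificationIdx' w.asIdeal := by
  rw [Ideal.ramificationIdxIn_eq_ramificationIdx _ w.asIdeal Gal(L/K),
    Ideal.ramificationIdx'_eq_ramificationIdx _ _ (w.under (𝓞 K)).ne_bot]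

/-- On `K`, the valuation at `w` is the `e`-th power of the valuation below it; extension of ideals
is therefore `inflate` by ramification indices. -/
theorem ordUnit_algebraMap [IsGalois K L] (x : Kˣ) :
    ordUnit L (primesAbove L S) (Units.map (algebraMap K L).toMonoidHom x) =
      inflate (primeBelow_eq_iff S) (fun v => v.1.asIdeal.ramificationIdxIn (𝓞 L))
        (ordUnit K S x) := by
  apply Multiplicative.toAdd.injective
  ext w
  rw [inflate_apply]
  have h := HeightOneSpectrum.valuation_liesOver L (w.1.under (𝓞 K)) w.1 (x : K)
  have h1 := valuation_eq_exp_neg_ordUnit x (primeBelow L S w)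
  have h2 := valuation_eq_exp_neg_ordUnit (Units.map (algebraMap K L).toMonoidHom x) w
  change (w.1.under (𝓞 K)).valuation K (x : K) = _ at h1
  change w.1.valuation L (algebraMap K L x) = _ at h2
  rw [h1, h2, ← WithZero.exp_nsmul, WithZero.exp_inj, ← ramificationIdxIn_eq, nsmul_eq_mul,
    mul_neg, neg_inj] at h
  exact h.symm

/-- Ramified primes lie below divisors of the different, which is nonzero. -/
theorem finite_ramified [IsGalois K L] :
    {v : HeightOneSpectrum (𝓞 K) | v.asIdeal.ramificationIdxIn (𝓞 L) ≠ 1}.Finite := by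
  have h := Ideal.finite_factors (differentIdeal_ne_bot (A := 𝓞 K) (B := 𝓞 L))
  refine (h.image (fun w => w.under (𝓞 K))).subset fun v hv => ?_
  obtain ⟨w, hw⟩ := exists_liesOver L v
  have hwv : w.under (𝓞 K) = v := HeightOneSpectrum.ext hw.over.symm
  refine ⟨w, ?_, hwv⟩
  by_contra hd
  refine hv ?_
  have : Algebra.IsUnramifiedAt (𝓞 K) w.asIdeal := (not_dvd_differentIdeal_iff).1 hd
  rw [Ideal.ramificationIdxIn_eq_ramificationIdx _ w.asIdeal Gal(L/K)]
  exact Ideal.ramificationIdx_eq_one_of_isUnramifiedAt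

end GaloisAction

/-! ### Maps of discretely valued fields that raise valuations to a power. -/

section Valued

open Topology Filter
open scoped WithZero

variable {E F : Type*} [Field E] [Field F] [Valued E ℤᵐ⁰] [Valued F ℤᵐ⁰]

theorem hasBasis_nhds_zero_of_surjective (hE : Function.Surjective (Valued.v : E → ℤᵐ⁰)) :
    (𝓝 (0 : E)).HasBasis (fun γ : ℤᵐ⁰ => γ ≠ 0) fun γ => {x | Valued.v x < γ} := by
  refine ⟨fun s => ?_⟩
  rw [Valued.mem_nhds_zero]
  constructor
  · rintro ⟨γ, hγ⟩
    refine ⟨MonoidWithZeroHom.ValueGroup₀.embedding γ.1, ?_, fun x hx => hγ ?_⟩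
    · simp
    · exact (Valuation.restrict_lt_iff_lt_embedding _).2 hx
  · rintro ⟨γ, hγ, h⟩
    obtain ⟨y, rfl⟩ := hE γ
    refine ⟨Units.mk0 (Valued.v.restrict y) (by simpa using hγ), fun x hx => h ?_⟩
    exact (Valued.v.restrict_lt_iff).1 hx

theorem isUniformInducing_of_valued (hE : Function.Surjective (Valued.v : E → ℤᵐ⁰))
    (hF : Function.Surjective (Valued.v : F → ℤᵐ⁰)) (f : E →+* F) {e : ℕ} (he : e ≠ 0)
    (h : ∀ x, Valued.v (f x) = Valued.v x ^ e) : IsUniformInducing f := by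
  have key : 𝓝 (0 : E) = comap f (𝓝 0) := by
    refine (hasBasis_nhds_zero_of_surjective hE).ext
      ((hasBasis_nhds_zero_of_surjective hF).comap f) (fun γ hγ => ?_) fun γ hγ => ?_
    · refine ⟨γ ^ e, pow_ne_zero _ hγ, fun x hx => ?_⟩
      simp only [Set.mem_preimage, Set.mem_ofPred_eq, h] at hx ⊢
      exact lt_of_pow_lt_pow_left' e hx
    -- Where the valuation is less than `1`, its `e`-th power does not exceed it.
    · refine ⟨min 1 γ, by rcases min_choice 1 γ with h | h <;> simp [h, hγ], fun x hx => ?_⟩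
      simp only [Set.mem_preimage, Set.mem_ofPred_eq, h, lt_min_iff] at hx ⊢
      exact (pow_le_of_le_one zero_le hx.1.le he).trans_lt hx.2
  refine ⟨?_⟩
  rw [uniformity_eq_comap_nhds_zero, uniformity_eq_comap_nhds_zero, comap_comap, key, comap_comap]
  congr 1
  ext x
  simp

/-- Valuations are locally constant away from `0`: some `y ∈ s` is so close to `x` that `x, y` and
also `f x, f y` have equal valuations. -/
theorem valued_map_eq_of_dense (hE : Function.Surjective (Valued.v : E → ℤᵐ⁰))
    (hF : Function.Surjective (Valued.v : F → ℤᵐ⁰)) {f : E →+* F} (hf : Continuous f)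
    {e : ℕ} (he : e ≠ 0) {s : Set E} (hs : Dense s)
    (h : ∀ x ∈ s, Valued.v (f x) = Valued.v x ^ e) (x : E) :
    Valued.v (f x) = Valued.v x ^ e := by
  rcases eq_or_ne x 0 with rfl | hx
  · simp [he]
  have hx' : Valued.v x ≠ 0 := by simpa using hx
  have h1 : {y : E | Valued.v y < Valued.v x} ∈ 𝓝 (0 : E) :=
    (hasBasis_nhds_zero_of_surjective hE).mem_of_mem hx'
  have h2 : {y : F | Valued.v y < Valued.v x ^ e} ∈ 𝓝 (0 : F) :=
    (hasBasis_nhds_zero_of_surjective hF).mem_of_mem (pow_ne_zero _ hx')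
  have h3 : f ⁻¹' {y : F | Valued.v y < Valued.v x ^ e} ∈ 𝓝 (0 : E) := by
    apply hf.continuousAt
    rwa [map_zero]
  have h4 : Tendsto (fun y => y - x) (𝓝 x) (𝓝 0) := by
    have : Continuous fun y : E => y - x := by fun_prop
    simpa using this.tendsto x
  obtain ⟨y, hy, hys⟩ := mem_closure_iff_nhds.1 (hs x) _ (h4 (inter_mem h1 h3))
  have e1 : Valued.v y = Valued.v x := Valuation.map_eq_of_sub_lt _ hy.1
  have h5 : Valued.v (f (y - x)) < Valued.v x ^ e := hy.2
  rw [map_sub, ← e1, ← h y hys, Valuation.map_sub_swap] at h5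
  rw [Valuation.map_eq_of_sub_lt _ h5, h y hys, e1]

end Valued

/-! ### Finite local degrees as orders of decomposition groups. -/

section Completion

variable {K : Type*} [Field K] [NumberField K] {L : Type*} [Field L] [NumberField L] [Algebra K L]

open MulAction
open scoped WithZero

theorem completionMap_coe (v : HeightOneSpectrum (𝓞 K)) (w : HeightOneSpectrum (𝓞 L))
    [w.asIdeal.LiesOver v.asIdeal] (x : K) :
    completionMap L v w (algebraMap K (v.adicCompletion K) x) =
      algebraMap L (w.adicCompletion L) (algebraMap K L x) := by
  apply HeightOneSpectrum.adicCompletion.ext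
  exact UniformSpace.Completion.mapRingHom_coe
      (HeightOneSpectrum.uniformContinuous_algebraMap_liesOver K L v w).continuous
      (WithVal.toVal (v.valuation K) x)

theorem continuous_completionMap (v : HeightOneSpectrum (𝓞 K)) (w : HeightOneSpectrum (𝓞 L))
    [w.asIdeal.LiesOver v.asIdeal] : Continuous (completionMap L v w) :=
  ((HeightOneSpectrum.adicCompletion.uniformEquiv L w).symm.continuous.comp
    UniformSpace.Completion.continuous_map).comp
      (HeightOneSpectrum.adicCompletion.uniformEquiv K v).continuous

theorem valued_completionMap (v : HeightOneSpectrum (𝓞 K)) (w : HeightOneSpectrum (𝓞 L))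
    [w.asIdeal.LiesOver v.asIdeal] (x : v.adicCompletion K) :
    Valued.v (completionMap L v w x) =
      Valued.v x ^ v.asIdeal.ramificationIdx' w.asIdeal := by
  refine valued_map_eq_of_dense (HeightOneSpectrum.valuedAdicCompletion_surjective K v)
    (HeightOneSpectrum.valuedAdicCompletion_surjective L w) (continuous_completionMap v w)
    (Ideal.IsDedekindDomain.ramificationIdx'_ne_zero_of_liesOver w.asIdeal v.ne_bot)
    (HeightOneSpectrum.denseRange_algebraMap K v) ?_ x
  rintro _ ⟨y, rfl⟩
  rw [completionMap_coe]
  exact ((HeightOneSpectrum.valuedAdicCompletion_eq_valuation' w _).trans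
    (HeightOneSpectrum.valuation_liesOver L v w y).symm).trans
    (congrArg (· ^ _) (HeightOneSpectrum.valuedAdicCompletion_eq_valuation' v y).symm)

theorem isClosed_range_completionMap (v : HeightOneSpectrum (𝓞 K)) (w : HeightOneSpectrum (𝓞 L))
    [w.asIdeal.LiesOver v.asIdeal] : IsClosed (Set.range (completionMap L v w)) :=
  ((isUniformInducing_of_valued (HeightOneSpectrum.valuedAdicCompletion_surjective K v)
    (HeightOneSpectrum.valuedAdicCompletion_surjective L w) _
    (Ideal.IsDedekindDomain.ramificationIdx'_ne_zero_of_liesOver w.asIdeal v.ne_bot)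
    (valued_completionMap v w)).isComplete_range).isClosed

variable (w : HeightOneSpectrum (𝓞 L))

theorem valuation_stabilizer (σ : stabilizer Gal(L/K) w) (x : L) :
    w.valuation L (σ.1 x) = w.valuation L x := by
  have h := valuation_smul σ.1 w x
  rwa [show σ.1 • w = w from σ.2] at h

theorem continuous_map_stabilizer (σ : stabilizer Gal(L/K) w) :
    Continuous (WithVal.map (w.valuation L) (w.valuation L) (σ.1 : L →+* L)) := by
  have h : Function.Surjective (Valued.v : WithVal (w.valuation L) → ℤᵐ⁰) :=
    fun x => by
      obtain ⟨y, hy⟩ := w.valuation_surjective L x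
      exact ⟨WithVal.toVal _ y, hy⟩
  refine (isUniformInducing_of_valued h h _ one_ne_zero fun x => ?_).uniformContinuous.continuous
  rw [pow_one]
  exact valuation_stabilizer w σ x.ofVal

/-- The action of the decomposition group of `w` on the completion of `L` at `w`. -/
def completionAut (σ : stabilizer Gal(L/K) w) : w.adicCompletion L →+* w.adicCompletion L :=
  ((HeightOneSpectrum.adicCompletion.equiv L w).symm.toRingHom.comp
    (UniformSpace.Completion.mapRingHom _ (continuous_map_stabilizer w σ))).comp
    (HeightOneSpectrum.adicCompletion.equiv L w).toRingHom

theorem completionAut_coe (σ : stabilizer Gal(L/K) w) (x : L) :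
    completionAut w σ (algebraMap L (w.adicCompletion L) x) =
      algebraMap L (w.adicCompletion L) (σ.1 x) := by
  apply HeightOneSpectrum.adicCompletion.ext
  exact UniformSpace.Completion.mapRingHom_coe (continuous_map_stabilizer w σ)
      (WithVal.toVal (w.valuation L) x)

theorem continuous_completionAut (σ : stabilizer Gal(L/K) w) : Continuous (completionAut w σ) :=
  ((HeightOneSpectrum.adicCompletion.uniformEquiv L w).symm.continuous.comp
    UniformSpace.Completion.continuous_map).comp
      (HeightOneSpectrum.adicCompletion.uniformEquiv L w).continuous

theorem valued_completionAut (σ : stabilizer Gal(L/K) w) (x : w.adicCompletion L) :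
    Valued.v (completionAut w σ x) = Valued.v x := by
  have := valued_map_eq_of_dense (HeightOneSpectrum.valuedAdicCompletion_surjective L w)
    (HeightOneSpectrum.valuedAdicCompletion_surjective L w) (continuous_completionAut w σ)
    one_ne_zero (HeightOneSpectrum.denseRange_algebraMap L w) ?_ x
  · rwa [pow_one] at this
  rintro _ ⟨y, rfl⟩
  rw [completionAut_coe, pow_one]
  exact ((HeightOneSpectrum.valuedAdicCompletion_eq_valuation' w _).trans
    (valuation_stabilizer w σ y)).trans
    (HeightOneSpectrum.valuedAdicCompletion_eq_valuation' w y).symm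

/-- The decomposition group of `w` as a monoid of endomorphisms of the completion at `w`. -/
def completionAutHom : stabilizer Gal(L/K) w →* (w.adicCompletion L →+* w.adicCompletion L) where
  toFun := completionAut w
  map_one' := by
    apply RingHom.coe_inj
    refine (HeightOneSpectrum.denseRange_algebraMap L w).equalizer
      (continuous_completionAut w 1) continuous_id (funext fun x => ?_)
    exact completionAut_coe w 1 x
  map_mul' σ τ := by
    apply RingHom.coe_inj
    refine (HeightOneSpectrum.denseRange_algebraMap L w).equalizer
      (continuous_completionAut w (σ * τ))
      ((continuous_completionAut w σ).comp (continuous_completionAut w τ)) (funext fun x => ?_)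
    change completionAut w (σ * τ) (algebraMap L (w.adicCompletion L) x) =
      completionAut w σ (completionAut w τ (algebraMap L (w.adicCompletion L) x))
    rw [completionAut_coe, completionAut_coe, completionAut_coe]
    rfl

/-- The action of the decomposition group of `w` on the completion of `L` at `w`. -/
@[reducible]
def completionAction : MulSemiringAction (stabilizer Gal(L/K) w) (w.adicCompletion L) :=
  MulSemiringAction.compHom _ (completionAutHom w)

theorem exists_mul_exp_neg_lt (a : ℤᵐ⁰) {γ : ℤᵐ⁰} (hγ : γ ≠ 0) :
    ∃ M : ℕ, a * WithZero.exp (-(M : ℤ)) < γ := by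
  rcases eq_or_ne a 0 with rfl | ha
  · exact ⟨0, by simpa using zero_lt_iff.2 hγ⟩
  · refine ⟨(WithZero.log a - WithZero.log γ).toNat + 1, ?_⟩
    rw [← WithZero.exp_log ha, ← WithZero.exp_log hγ, ← WithZero.exp_add, WithZero.exp_lt_exp]
    simp only [WithZero.log_exp]
    omega

/-- Take `y ∈ L` close to `x` and multiply it by an integer `t` from the Chinese remainder theorem,
close to `1` at `w` and to `0` at the other conjugates of `w`. The exponents `M` absorb the possible
poles of `y`. -/
theorem exists_approx (x : w.adicCompletion L) {γ : ℤᵐ⁰} (hγ : γ ≠ 0) :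
    ∃ z : L, Valued.v (algebraMap L (w.adicCompletion L) z - x) < γ ∧
      ∀ g : Gal(L/K), g • w ≠ w → w.valuation L (g z) < γ := by
  classical
  obtain ⟨y, hy⟩ : ∃ y : L, Valued.v (algebraMap L (w.adicCompletion L) y - x) < γ := by
    have h : {b : w.adicCompletion L | Valued.v (b - x) < γ} ∈ nhds x := by
      have h1 := (hasBasis_nhds_zero_of_surjective
        (HeightOneSpectrum.valuedAdicCompletion_surjective L w)).mem_of_mem hγ
      have h2 : Continuous fun b : w.adicCompletion L => b - x := by fun_prop
      have h3 := h2.tendsto x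
      rw [sub_self] at h3
      exact h3 h1
    obtain ⟨_, hb, y, rfl⟩ := mem_closure_iff_nhds.1
      (HeightOneSpectrum.denseRange_algebraMap L w x) _ h
    exact ⟨y, hb⟩
  choose M hM using fun w' : HeightOneSpectrum (𝓞 L) =>
    exists_mul_exp_neg_lt (w'.valuation L y) hγ
  obtain ⟨t, ht⟩ := IsDedekindDomain.exists_forall_sub_mem_ideal
    (s := Finset.univ.image fun g : Gal(L/K) => g • w) (fun w' => w'.asIdeal) M
    (fun w' _ => w'.prime) (fun w₁ _ w₂ _ h h' => h (HeightOneSpectrum.ext h'))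
    (fun w' => if w'.1 = w then 1 else 0)
  have key : ∀ (w' : HeightOneSpectrum (𝓞 L)) (r : 𝓞 L), r ∈ w'.asIdeal ^ M w' →
      w'.valuation L (y * algebraMap (𝓞 L) L r) < γ := by
    intro w' r hr
    rw [map_mul, HeightOneSpectrum.valuation_of_algebraMap]
    exact (mul_le_mul_right ((w'.intValuation_le_pow_iff_mem r _).2 hr) _).trans_lt (hM w')
  refine ⟨y * algebraMap (𝓞 L) L t, ?_, fun g hg => ?_⟩
  · have h1 := ht w (Finset.mem_image.2 ⟨1, Finset.mem_univ _, one_smul _ _⟩)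
    rw [if_pos rfl] at h1
    have h2 := key w _ h1
    rw [← HeightOneSpectrum.valuedAdicCompletion_eq_valuation' w] at h2
    have h3 : algebraMap L (w.adicCompletion L) (y * algebraMap (𝓞 L) L t) - x =
        algebraMap L (w.adicCompletion L) (y * algebraMap (𝓞 L) L (t - 1)) +
          (algebraMap L (w.adicCompletion L) y - x) := by
      rw [map_sub, map_one, mul_sub, mul_one, map_sub]
      ring
    rw [h3]
    exact Valuation.map_add_lt _ h2 hy
  -- The valuation of `g z` at `w` is that of `z` at `g⁻¹ • w`, a conjugate other than `w`.
  · have h1 := ht (g⁻¹ • w) (Finset.mem_image.2 ⟨g⁻¹, Finset.mem_univ _, rfl⟩)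
    rw [if_neg (fun h => hg (inv_smul_eq_iff.1 h).symm), sub_zero] at h1
    have h2 := key _ _ h1
    rwa [← valuation_smul g, smul_inv_smul] at h2

/-- For `z` as in `exists_approx`, each term of the trace of `z` indexed by the decomposition group
is close to `x`, and the others are small. Hence `d * x` is a limit of elements of `K`; the image of
`K_v` is closed and contains the nonzero integer `d`. -/
theorem mem_range_completionMap_of_fixed [IsGalois K L] (v : HeightOneSpectrum (𝓞 K))
    [w.asIdeal.LiesOver v.asIdeal] {x : w.adicCompletion L}
    (hx : ∀ σ : stabilizer Gal(L/K) w, completionAut w σ x = x) :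
    x ∈ (completionMap L v w).range := by
  classical
  have hchar : CharZero (w.adicCompletion L) :=
    charZero_of_injective_algebraMap (algebraMap L (w.adicCompletion L)).injective
  set d := Fintype.card (stabilizer Gal(L/K) w) with hd
  have hd0 : (d : w.adicCompletion L) ≠ 0 := by
    rw [Nat.cast_ne_zero]; exact Fintype.card_ne_zero
  suffices (d : w.adicCompletion L) * x ∈ (completionMap L v w).range by
    have h := mul_mem (inv_mem (natCast_mem (completionMap L v w).fieldRange d)) this
    rwa [inv_mul_cancel_left₀ hd0] at h
  change _ ∈ Set.range (completionMap L v w)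
  rw [← (isClosed_range_completionMap v w).closure_eq, mem_closure_iff_nhds]
  intro U hU
  have hU' : {b | b + (d : w.adicCompletion L) * x ∈ U} ∈ nhds (0 : w.adicCompletion L) := by
    have h2 : Continuous fun b : w.adicCompletion L => b + (d : w.adicCompletion L) * x := by
      fun_prop
    have h3 := h2.tendsto 0
    rw [zero_add] at h3
    exact h3 hU
  obtain ⟨γ, hγ, hγU⟩ := (hasBasis_nhds_zero_of_surjective
        (HeightOneSpectrum.valuedAdicCompletion_surjective L w)).mem_iff.1 hU'
  obtain ⟨z, hz, hz'⟩ := exists_approx (K := K) w x hγ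
  refine ⟨_, ?_, algebraMap K _ (Algebra.trace K L z), rfl⟩
  rw [completionMap_coe, trace_eq_sum_automorphisms]
  have h1 : Valued.v (algebraMap L (w.adicCompletion L) (∑ σ : Gal(L/K), σ z) - d * x) < γ := by
    have h2 : (d : w.adicCompletion L) * x =
        ∑ g : Gal(L/K), if g ∈ stabilizer Gal(L/K) w then x else 0 := by
      rw [Finset.sum_ite, Finset.sum_const_zero, add_zero, Finset.sum_const, nsmul_eq_mul, hd,
        Fintype.card_subtype]
    rw [h2, map_sum, ← Finset.sum_sub_distrib]
    refine Valuation.map_sum_lt _ hγ fun g _ => ?_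
    split_ifs with hg
    · rw [← valued_completionAut w ⟨g, hg⟩, map_sub, hx, completionAut_coe] at hz
      exact hz
    · rw [sub_zero]
      exact (HeightOneSpectrum.valuedAdicCompletion_eq_valuation' w _).trans_lt (hz' g hg)
  have := hγU h1
  simpa using this

theorem completionAut_completionMap (v : HeightOneSpectrum (𝓞 K))
    [w.asIdeal.LiesOver v.asIdeal] (σ : stabilizer Gal(L/K) w) (x : v.adicCompletion K) :
    completionAut w σ (completionMap L v w x) = completionMap L v w x := by
  refine congrFun ((HeightOneSpectrum.denseRange_algebraMap K v).equalizer
    ((continuous_completionAut w σ).comp (continuous_completionMap v w))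
    (continuous_completionMap v w) (funext fun y => ?_)) x
  simp only [Function.comp_apply]
  rw [completionMap_coe, completionAut_coe, AlgEquiv.commutes]

/-- Artin's theorem for the decomposition group acting on `L_w`: the action is faithful already on
`L`, and its fixed field is the image of `K_v`. -/
theorem finrank_adicCompletion [IsGalois K L] (v : HeightOneSpectrum (𝓞 K))
    [w.asIdeal.LiesOver v.asIdeal] :
    letI := (completionMap L v w).toAlgebra
    Module.finrank (v.adicCompletion K) (w.adicCompletion L) =
      Nat.card (stabilizer Gal(L/K) w) := by
  classical
  let := (completionMap L v w).toAlgebra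
  let := completionAction (K := K) w
  have hfaith : FaithfulSMul (stabilizer Gal(L/K) w) (w.adicCompletion L) := by
    refine ⟨fun {σ τ} h => Subtype.ext (AlgEquiv.ext fun x => ?_)⟩
    have h1 : completionAut w σ (algebraMap L _ x) = completionAut w τ (algebraMap L _ x) := h _
    rw [completionAut_coe, completionAut_coe] at h1
    exact (algebraMap L (w.adicCompletion L)).injective h1
  have hrange : (completionMap L v w).fieldRange =
      FixedPoints.subfield (stabilizer Gal(L/K) w) (w.adicCompletion L) := by
    ext x
    constructor
    · rintro ⟨y, rfl⟩ σ
      exact completionAut_completionMap w v σ y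
    · exact fun hx => mem_range_completionMap_of_fixed w v hx
  rw [Nat.card_eq_fintype_card, ← FixedPoints.finrank_eq_card _ (w.adicCompletion L)]
  refine Algebra.finrank_eq_of_equiv_equiv
    ((completionMap L v w).rangeRestrictFieldEquiv.trans (RingEquiv.subfieldCongr hrange))
    (RingEquiv.refl _) ?_
  rfl

theorem localDegree_eq_card_stabilizer [IsGalois K L] (v : HeightOneSpectrum (𝓞 K)) :
    ∃ w : HeightOneSpectrum (𝓞 L), w.under (𝓞 K) = v ∧
      localDegree L v = Nat.card (stabilizer Gal(L/K) w) := by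
  have := (exists_liesOver L v).choose_spec
  exact ⟨(exists_liesOver L v).choose, HeightOneSpectrum.ext this.over.symm,
    finrank_adicCompletion _ v⟩

end Completion

/-! ### Homomorphisms out of a finitely generated free abelian group. -/

section ProdHom

variable {ι M N : Type*} [Fintype ι] [CommGroup M] [CommGroup N]

/-- The homomorphism from the free abelian group on `ι` that sends the basis vectors to the given
elements. -/
def prodHom (ε : ι → M) : Multiplicative (ι →₀ ℤ) →* M where
  toFun a := ∏ w, ε w ^ a.toAdd w
  map_one' := by simp
  map_mul' a b := by simp [zpow_add, Finset.prod_mul_distrib]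

theorem prodHom_apply (ε : ι → M) (a : Multiplicative (ι →₀ ℤ)) :
    prodHom ε a = ∏ w, ε w ^ a.toAdd w := rfl

theorem map_prodHom (f : M →* N) (ε : ι → M) (a : Multiplicative (ι →₀ ℤ)) :
    f (prodHom ε a) = prodHom (fun w => f (ε w)) a := by
  simp [prodHom_apply, map_prod, map_zpow]

theorem range_prodHom (ε : ι → M) : (prodHom ε).range = Subgroup.closure (Set.range ε) := by
  classical
  refine le_antisymm ?_ ((Subgroup.closure_le _).2 ?_)
  · rintro _ ⟨a, rfl⟩
    exact prod_mem fun w _ => zpow_mem (Subgroup.subset_closure (Set.mem_range_self w)) _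
  · rintro _ ⟨w, rfl⟩
    refine ⟨Multiplicative.ofAdd (Finsupp.single w 1), ?_⟩
    rw [prodHom_apply, Finset.prod_eq_single w]
    · simp
    · intro w' _ h
      simp [Finsupp.single_eq_of_ne h]
    · simp

theorem prodHom_permHom {G : Type*} [Group G] [MulAction G ι] {ρ : G → M →* M} {ε : ι → M}
    (h : ∀ g w, ρ g (ε w) = ε (g • w)) (g : G) (a : Multiplicative (ι →₀ ℤ)) :
    prodHom ε (permHom g a) = ρ g (prodHom ε a) := by
  rw [map_prodHom, prodHom_apply, prodHom_apply]
  refine (Fintype.prod_equiv (MulAction.toPerm g) _ _ fun w => ?_).symm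
  rw [MulAction.toPerm_apply, permHom_apply, inv_smul_smul, h]

/-- An injection between groups of equal finite rank has a finitely generated torsion cokernel,
which is finite. -/
theorem index_range_ne_zero (φ : Multiplicative (ι →₀ ℤ) →* M) (hφ : Function.Injective φ)
    {Q : Type*} [AddCommGroup Q] [Module.Finite ℤ Q] (e : Additive M ≃+ Q)
    (hQ : Module.finrank ℤ Q = Fintype.card ι) : φ.range.index ≠ 0 := by
  have h : Module.finrank ℤ (Additive M) = Fintype.card ι :=
    e.toIntLinearEquiv.finrank_eq.trans hQ
  have := Module.Finite.equiv e.symm.toIntLinearEquiv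
  let f : (ι →₀ ℤ) →+ Additive M :=
    { toFun := fun a => Additive.ofMul (φ (Multiplicative.ofAdd a))
      map_zero' := by simp
      map_add' := fun a b => by simp }
  have hf : Function.Injective f.toIntLinearMap := fun a b hab => hφ hab
  have h1 := Submodule.finrank_quotient_add_finrank (LinearMap.range f.toIntLinearMap)
  rw [LinearMap.finrank_range_of_inj hf, h, Module.finrank_finsupp_self, Nat.add_eq_right] at h1
  have h2 : Finite (Additive M ⧸ LinearMap.range f.toIntLinearMap) :=
    Module.finite_of_fg_torsion _ (Module.finrank_eq_zero_iff_isTorsion.1 h1)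
  have h3 : φ.range.toAddSubgroup = (LinearMap.range f.toIntLinearMap).toAddSubgroup := by
    ext x; rfl
  rw [← Subgroup.index_toAddSubgroup, h3]
  have h4 : Finite (Additive M ⧸ (LinearMap.range f.toIntLinearMap).toAddSubgroup) := h2
  exact AddSubgroup.index_ne_zero_of_finite

end ProdHom

/-! ### Equivariant families and the Herbrand quotient. -/

section Herbrand

variable {G Ω V A : Type*} [Group G] [Fintype G] [MulAction G Ω] [CommGroup A]

/-- In every orbit choose a representative; an arbitrary family then yields an equivariant one. -/
theorem exists_equivariant {ρ : G → A →* A} (hρ : ∀ g h a, ρ (g * h) a = ρ g (ρ h a))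
    (u : Ω → A) : ∃ ε : Ω → A, (∀ g w, ρ g (ε w) = ε (g • w)) ∧
      ∀ w, ∃ w₀, ∃ t : Finset G, t.Nonempty ∧ (∀ g ∈ t, g • w₀ = w) ∧
        ε w = ∏ g ∈ t, ρ g (u w₀) := by
  classical
  let r : Ω → Ω := fun w => (Quotient.mk'' w : MulAction.orbitRel.Quotient G Ω).out
  have hr : ∀ (g : G) w, r (g • w) = r w := fun g w =>
    congrArg Quotient.out (Quotient.sound' ⟨g, rfl⟩)
  -- One `g` carrying the representative to `w` is determined only up to the stabilizer; the product
  -- over all such `g` is canonical, hence equivariant.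
  refine ⟨fun w => ∏ g with g • r w = w, ρ g (u (r w)), fun g w => ?_, fun w =>
    ⟨r w, Finset.univ.filter fun g => g • r w = w, ?_, fun g hg => (Finset.mem_filter.1 hg).2, rfl⟩⟩
  · simp only [map_prod, ← hρ, hr]
    refine Finset.prod_equiv (Equiv.mulLeft g) (fun h => ?_) fun h _ => rfl
    simp [mul_smul]
  · obtain ⟨g, hg⟩ : w ∈ MulAction.orbit G (r w) := by
      rw [← MulAction.orbitRel_apply]
      exact Quotient.exact (s := MulAction.orbitRel G Ω) (Quotient.out_eq _).symm
    exact ⟨g, by simpa using hg⟩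

variable [Fintype Ω] [Finite V] {π : Ω → V}

/-- The Herbrand quotient of a module which contains, with finite index, a permutation module. -/
theorem herbrand_of_permutation (hπ : Function.Surjective π)
    (hG : ∀ w w', π w = π w' ↔ ∃ g : G, g • w = w') {s : G} (hs : ∀ g, g ∈ Subgroup.zpowers s)
    {ρ : G → A →* A} (hρ : ∀ g h a, ρ (g * h) a = ρ g (ρ h a)) {ε : Ω → A}
    (hε : ∀ g w, ρ g (ε w) = ε (g • w)) (hinj : Function.Injective (prodHom ε)) {W : Subgroup A}
    (hW : ∀ g, ∀ a ∈ W, ρ g a ∈ W) (hle : (prodHom ε).range ≤ W)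
    (hfin : (prodHom ε).range.relIndex W ≠ 0) :
    (W.map (diffHom (ρ s))).relIndex (W ⊓ (normHom ρ).ker) ≠ 0 ∧
    (W.map (normHom ρ)).relIndex (W ⊓ (diffHom (ρ s)).ker) =
      (∏ᶠ v, Nat.card (MulAction.stabilizer G (Function.surjInv hπ v))) *
        (W.map (diffHom (ρ s))).relIndex (W ⊓ (normHom ρ).ker) := by
  set φ := prodHom ε
  set fP := diffHom (permHom (Ω := Ω) s)
  set gP := normHom fun g : G => permHom (Ω := Ω) g
  have hφ : ∀ g a, φ (permHom g a) = ρ g (φ a) := prodHom_permHom hε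
  have hf : ∀ a, φ (fP a) = diffHom (ρ s) (φ a) := map_diffHom φ (hφ s)
  have hg : ∀ a, φ (gP a) = normHom ρ (φ a) := map_normHom φ hφ
  have hmap : ∀ (k : A →* A) (kP : Multiplicative (Ω →₀ ℤ) →* Multiplicative (Ω →₀ ℤ)),
      (∀ a, φ (kP a) = k (φ a)) → φ.range.map k = kP.range.map φ := by
    intro k kP h
    rw [← MonoidHom.range_comp, ← MonoidHom.range_comp]
    exact congrArg MonoidHom.range (MonoidHom.ext fun a => (h a).symm)
  have hker : ∀ (k : A →* A) (kP : Multiplicative (Ω →₀ ℤ) →* Multiplicative (Ω →₀ ℤ)),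
      (∀ a, φ (kP a) = k (φ a)) → φ.range ⊓ k.ker = kP.ker.map φ := by
    intro k kP h
    ext x
    constructor
    · rintro ⟨⟨a, rfl⟩, ha⟩
      refine ⟨a, hinj ?_, rfl⟩
      rw [h, map_one]
      exact ha
    · rintro ⟨a, ha, rfl⟩
      refine ⟨⟨a, rfl⟩, ?_⟩
      change k (φ a) = 1
      rw [← h, MonoidHom.mem_ker.1 ha, map_one]
  have hstab : ∀ v, Nat.card (MulAction.stabilizer G (Function.surjInv hπ v)) ≠ 0 :=
    fun v => Nat.card_pos.ne'
  -- For the permutation module the norm index is the product of the stabilizer orders, and the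
  -- other index (`e1`) is `1`.
  have e0 : (φ.range.map (normHom ρ)).relIndex (φ.range ⊓ (diffHom (ρ s)).ker) =
      ∏ᶠ v, Nat.card (MulAction.stabilizer G (Function.surjInv hπ v)) := by
    rw [hmap _ _ hg, hker _ _ hf, Subgroup.relIndex_map_map_of_injective _ _ hinj,
      range_normHom_permHom hπ hG, relIndex_range_inflate hπ hG (Set.toFinite _) hs]
  have e1 : (φ.range.map (diffHom (ρ s))).relIndex (φ.range ⊓ (normHom ρ).ker) = 1 := by
    rw [hmap _ _ hf, hker _ _ hg, Subgroup.relIndex_map_map_of_injective _ _ hinj,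
      ker_normHom_permHom hπ hG hs, Subgroup.relIndex_self]
  have hR : ∀ g, ∀ a ∈ φ.range, ρ g a ∈ φ.range := by
    rintro g _ ⟨a, rfl⟩
    exact ⟨_, hφ g a⟩
  have hd : ∀ X : Subgroup A, (∀ g, ∀ a ∈ X, ρ g a ∈ X) → X.map (diffHom (ρ s)) ≤ X := by
    rintro X hX _ ⟨a, ha, rfl⟩
    exact div_mem (hX _ _ ha) ha
  have hn : ∀ X : Subgroup A, (∀ g, ∀ a ∈ X, ρ g a ∈ X) → X.map (normHom ρ) ≤ X := by
    rintro X hX _ ⟨a, ha, rfl⟩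
    rw [normHom_apply]
    exact prod_mem fun g _ => hX _ _ ha
  obtain ⟨-, h1, h2⟩ := herbrand_eq_of_relIndex_ne_zero (diffHom (ρ s)) (normHom ρ)
    (diffHom_normHom hρ s) (normHom_diffHom hρ s) hle hfin (hd _ hR) (hn _ hR) (hd _ hW) (hn _ hW)
    (by rw [e0]; exact finprod_induction (· ≠ 0) one_ne_zero (fun _ _ => mul_ne_zero) hstab)
    (by rw [e1]; exact one_ne_zero)
  rw [e0, e1, mul_one] at h2
  exact ⟨h1, h2⟩

end Herbrand

/-! ### A Perron-type lemma on matrices with negative off-diagonal entries. -/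

section Perron

/-- If some `a j` were positive, add the rows over the positive indices. As the sum of `a` is zero
these are not all indices, so the partial column sums are positive at positive indices and
nonpositive elsewhere; the total would be positive. Hence all `a j ≤ 0`, and their sum vanishes. -/
theorem eq_zero_of_sum_col_eq_zero {ι : Type*} [Fintype ι] {A : ι → ι → ℝ}
    (hA : ∀ i j, i ≠ j → A i j < 0) (hcol : ∀ j, ∑ i, A i j = 0) {a : ι → ℝ}
    (ha : ∀ i, ∑ j, A i j * a j = 0) (hsum : ∑ j, a j = 0) : a = 0 := by
  classical
  have hpos : ∀ j, ¬ 0 < a j := by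
    intro j₀ hj₀
    have hne : ∃ k, a k ≤ 0 := by
      by_contra! h
      exact (Finset.sum_pos (fun j _ => h j) ⟨j₀, Finset.mem_univ _⟩).ne' hsum
    obtain ⟨k, hk⟩ := hne
    let P : Finset ι := {i | 0 < a i}
    have h0 : ∑ j, (∑ i ∈ P, A i j) * a j = 0 := by
      simp only [Finset.sum_mul]
      rw [Finset.sum_comm]
      exact Finset.sum_eq_zero fun i _ => ha i
    have hc : ∀ j, ∑ i ∈ P, A i j = -∑ i ∈ Pᶜ, A i j := by
      intro j
      rw [eq_neg_iff_add_eq_zero, Finset.sum_add_sum_compl, hcol]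
    refine (Finset.sum_pos' (fun j _ => ?_) ⟨j₀, Finset.mem_univ _, ?_⟩).ne' h0
    · by_cases hj : 0 < a j
      · rw [hc]
        refine mul_nonneg (neg_nonneg.2 (Finset.sum_nonpos fun i hi => (hA i j ?_).le)) hj.le
        rintro rfl
        exact absurd hj (by simpa [P] using hi)
      · refine mul_nonneg_of_nonpos_of_nonpos (Finset.sum_nonpos fun i hi => (hA i j ?_).le)
          (not_lt.1 hj)
        rintro rfl
        exact hj (by simpa [P] using hi)
    · rw [hc]
      refine mul_pos (neg_pos.2 (Finset.sum_neg (fun i hi => hA i j₀ ?_) ⟨k, ?_⟩)) hj₀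
      · rintro rfl
        exact absurd hj₀ (by simpa [P] using hi)
      · simpa [P] using hk
  funext j
  have h := (Finset.sum_eq_zero_iff_of_nonpos (fun j _ => not_lt.1 (hpos j))).1 hsum
  exact h j (Finset.mem_univ _)

end Perron

/-! ### Local degrees at the infinite places. -/

section Infinite

variable {K : Type*} [Field K] [NumberField K] {L : Type*} [Field L] [NumberField L] [Algebra K L]

open MulAction
open scoped NumberField.LiesOver

theorem localDegreeInfinite_eq_card_stabilizer [IsGalois K L] (v : InfinitePlace K) :
    ∃ w : InfinitePlace L, w.comap (algebraMap K L) = v ∧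
      localDegreeInfinite L v = Nat.card (stabilizer Gal(L/K) w) := by
  have hw := (exists_liesOver_infinite L v).choose_spec
  refine ⟨(exists_liesOver_infinite L v).choose, hw.comap_eq, ?_⟩
  rw [InfinitePlace.card_stabilizer]
  split_ifs with h
  · exact h.finrank_eq_one v
  · exact InfinitePlace.IsRamified.finrank_eq_two v h

theorem comap_eq_iff [IsGalois K L] (w w' : InfinitePlace L) :
    w.comap (algebraMap K L) = w'.comap (algebraMap K L) ↔ ∃ σ : Gal(L/K), σ • w = w' :=
  InfinitePlace.mem_orbit_iff.symm

end Infinite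
-- Equivariant families of units and of `S`-units.
section Units

variable {K : Type*} [Field K] [NumberField K] {L : Type*} [Field L] [NumberField L] [Algebra K L]

variable (K L) in
/-- The action of the Galois group on `Lˣ`. -/
def galUnit (σ : Gal(L/K)) : Lˣ →* Lˣ := Units.map (σ : L →* L)

theorem galUnit_mul (σ τ : Gal(L/K)) (x : Lˣ) :
    galUnit K L (σ * τ) x = galUnit K L σ (galUnit K L τ x) := rfl

/-- The action of the Galois group on the units of `L`. -/
def galInt (σ : Gal(L/K)) : (𝓞 L)ˣ →* (𝓞 L)ˣ :=
  Units.map (RingOfIntegers.mapRingEquiv (σ : L ≃+* L) : 𝓞 L →* 𝓞 L)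

theorem galInt_mul (σ τ : Gal(L/K)) (x : (𝓞 L)ˣ) :
    galInt (σ * τ) x = galInt σ (galInt τ x) := rfl

variable (L) in
/-- The inclusion of the units of `𝓞 L` in `Lˣ`. -/
def unitIncl : (𝓞 L)ˣ →* Lˣ := Units.map (algebraMap (𝓞 L) L : 𝓞 L →* L)

theorem unitIncl_injective : Function.Injective (unitIncl L) :=
  Units.map_injective RingOfIntegers.coe_injective

theorem mem_range_unitIncl {x : Lˣ} (h : ∀ w : HeightOneSpectrum (𝓞 L), w.valuation L (x : L) = 1) :
    x ∈ (unitIncl L).range := by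
  obtain ⟨a, ha⟩ := HeightOneSpectrum.mem_integers_of_valuation_le_one L (x : L) fun w => (h w).le
  obtain ⟨b, hb⟩ := HeightOneSpectrum.mem_integers_of_valuation_le_one L ((x⁻¹ : Lˣ) : L)
    fun w => by
    rw [Units.val_inv_eq_inv_val, map_inv₀, h, inv_one]
  refine ⟨⟨a, b, ?_, ?_⟩, Units.ext ha⟩ <;>
  · apply RingOfIntegers.coe_injective
    simp [ha, hb]

theorem valuation_unitIncl (x : (𝓞 L)ˣ) (w : HeightOneSpectrum (𝓞 L)) :
    w.valuation L (unitIncl L x : L) = 1 := by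
  have h : ∀ y : (𝓞 L)ˣ, w.valuation L (unitIncl L y : L) ≤ 1 := fun y => w.valuation_le_one _
  refine le_antisymm (h x) ?_
  have h1 := h x⁻¹
  rwa [map_inv, Units.val_inv_eq_inv_val, map_inv₀, inv_le_one₀ (by simp [zero_lt_iff])] at h1

theorem ordUnit_eq_one_iff {T : Set (HeightOneSpectrum (𝓞 L))} {x : Lˣ} :
    ordUnit L T x = 1 ↔ ∀ w ∉ T, w.valuation L (x : L) = 1 := by
  rw [← MonoidHom.mem_ker, ker_ordUnit]; rfl

/-- Dirichlet's theorem supplies, for each `w`, a unit less than `1` at all other infinite places.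
This survives the averaging of `exists_equivariant`, as every factor comes from a `g` carrying the
chosen place to `w`. -/
theorem exists_unit_family : ∃ ε : InfinitePlace L → (𝓞 L)ˣ,
    (∀ (σ : Gal(L/K)) w, galInt σ (ε w) = ε (σ • w)) ∧
      ∀ w w' : InfinitePlace L, w' ≠ w → Real.log (w' (ε w : L)) < 0 := by
  choose u hu using Units.dirichletUnitTheorem.exists_unit L
  obtain ⟨ε, h1, h2⟩ := exists_equivariant (G := Gal(L/K)) galInt_mul u
  refine ⟨ε, h1, fun w w' hw => ?_⟩
  obtain ⟨w₀, t, ht, htw, hε⟩ := h2 w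
  have h3 : (ε w : L) = ∏ g ∈ t, g (u w₀ : L) := by
    change ((unitIncl L (ε w) : Lˣ) : L) = _
    rw [hε, map_prod, Units.coe_prod]; rfl
  rw [h3, map_prod, Real.log_prod fun g _ => by simp]
  refine Finset.sum_neg (fun g hg => ?_) ht
  refine hu w₀ (g⁻¹ • w') ?_
  rw [Ne, inv_smul_eq_iff, htw g hg]
  exact hw

/-- The units alone are one too many to be independent. The extra coordinate in `ℤ` forces the
exponents to have sum zero, and the Perron lemma applies to the logarithm matrix, whose columns sum
to zero by the product formula. -/
theorem prodHom_unit_injective {ε : InfinitePlace L → (𝓞 L)ˣ}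
    (hε : ∀ w w' : InfinitePlace L, w' ≠ w → Real.log (w' (ε w : L)) < 0) :
    Function.Injective
      (prodHom fun w => ((ε w, Multiplicative.ofAdd 1) : (𝓞 L)ˣ × Multiplicative ℤ)) := by
  rw [injective_iff_map_eq_one]
  intro a ha
  have e1 : ∏ w, ε w ^ a.toAdd w = 1 := by
    have := congrArg (MonoidHom.fst _ _) ha
    rw [map_prodHom, prodHom_apply] at this
    exact this
  have e2 : ∑ w, a.toAdd w = 0 := by
    have := congrArg (MonoidHom.snd _ _) ha
    rw [map_prodHom, prodHom_apply] at this
    replace this := congrArg Multiplicative.toAdd this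
    rw [toAdd_prod] at this
    simp only [toAdd_zpow, MonoidHom.coe_snd, toAdd_ofAdd, smul_eq_mul, mul_one] at this
    exact this
  have h := eq_zero_of_sum_col_eq_zero (A := fun w' w => w'.mult * Real.log (w' (ε w : L)))
    (a := fun w => (a.toAdd w : ℝ))
    (fun w' w h => mul_neg_of_pos_of_neg (by simp [InfinitePlace.mult_pos]) (hε w w' h))
    (fun w => Units.sum_mult_mul_log (ε w)) (fun w' => ?_) (by exact_mod_cast e2)
  · apply Multiplicative.toAdd.injective
    ext w
    exact Int.cast_injective (α := ℝ) ((congrFun h w).trans Int.cast_zero.symm)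
  · have e3 : (∏ w, (ε w : L) ^ a.toAdd w) = 1 := by
      have := congrArg (fun x => ((unitIncl L x : Lˣ) : L)) e1
      simp only [map_prod, map_zpow, Units.coe_prod, map_one, Units.val_one,
        Units.val_zpow_eq_zpow_val] at this
      exact this
    have e4 := congrArg (fun x => Real.log (w' x)) e3
    simp only [map_prod, map_zpow₀, map_one, Real.log_one] at e4
    rw [Real.log_prod fun w _ => by simp [zpow_ne_zero]] at e4
    simp only [Real.log_zpow] at e4
    rw [← mul_zero (w'.mult : ℝ), ← e4, Finset.mul_sum]
    exact Finset.sum_congr rfl fun w _ => by ring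

theorem finrank_prod_int (M N : Type*) [AddCommGroup M] [AddCommGroup N] [Module.Finite ℤ M]
    [Module.Finite ℤ N] :
    Module.finrank ℤ (M × N) = Module.finrank ℤ M + Module.finrank ℤ N := by
  have h := Submodule.finrank_quotient_add_finrank (LinearMap.ker (LinearMap.snd ℤ M N))
  rw [((LinearMap.snd ℤ M N).quotKerEquivOfSurjective LinearMap.snd_surjective).finrank_eq,
    ← LinearMap.range_inl, LinearMap.finrank_range_of_inj LinearMap.inl_injective] at h
  rw [← h, add_comm]

/-- The factor `ℤ` raises the unit rank by one, to the number of infinite places. -/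
theorem index_range_prodHom_unit_ne_zero {ε : InfinitePlace L → (𝓞 L)ˣ}
    (hε : ∀ w w' : InfinitePlace L, w' ≠ w → Real.log (w' (ε w : L)) < 0) :
    (prodHom fun w =>
      ((ε w, Multiplicative.ofAdd 1) : (𝓞 L)ˣ × Multiplicative ℤ)).range.index ≠ 0 := by
  let e : Additive ((𝓞 L)ˣ × Multiplicative ℤ) ≃+ Additive (𝓞 L)ˣ × ℤ :=
    { toFun x := (Additive.ofMul x.toMul.1, x.toMul.2.toAdd)
      invFun y := Additive.ofMul (y.1.toMul, Multiplicative.ofAdd y.2)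
      left_inv _ := rfl
      right_inv _ := rfl
      map_add' _ _ := rfl }
  refine index_range_ne_zero _ (prodHom_unit_injective hε) e ?_
  rw [finrank_prod_int, Units.finrank_eq, Module.finrank_self, Units.rank]
  exact Nat.sub_add_cancel Fintype.card_pos

/-- With `c` the class number, `w ^ c` is principal; `x` is a generator, with nonzero valuation only
at `w`. -/
theorem exists_ordUnit_eq_single {T T' : Set (HeightOneSpectrum (𝓞 L))} (h : ∀ w ∉ T', w ∈ T)
    (w : {w // w ∉ T'}) : ∃ x : Lˣ, ordUnit L T x = 1 ∧
      ∃ c : ℕ, c ≠ 0 ∧ ordUnit L T' x = Multiplicative.ofAdd (Finsupp.single w (c : ℤ)) := by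
  classical
  let w' : {w : HeightOneSpectrum (𝓞 L) // w ∉ (∅ : Set (HeightOneSpectrum (𝓞 L)))} :=
    ⟨w.1, Set.notMem_empty _⟩
  obtain ⟨x, hx⟩ := Subgroup.pow_index_mem (ordUnit L ∅).range
    (Multiplicative.ofAdd (Finsupp.single w' (1 : ℤ)))
  set c := (ordUnit L ∅).range.index
  have key : ∀ (T'' : Set (HeightOneSpectrum (𝓞 L))) (y : {w // w ∉ T''}),
      (ordUnit L T'' x).toAdd y = if w.1 = y.1 then (c : ℤ) else 0 := by
    intro T'' y
    have h1 : (ordUnit L T'' x).toAdd y = (ordUnit L ∅ x).toAdd ⟨y.1, Set.notMem_empty _⟩ := rfl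
    rw [h1, hx, toAdd_pow, toAdd_ofAdd, Finsupp.smul_apply, Finsupp.single_apply]
    simp [w', Subtype.ext_iff]
  refine ⟨x, ?_, c, index_range_ordUnit_ne_zero L ∅, ?_⟩
  · apply Multiplicative.toAdd.injective
    ext y
    rw [key, if_neg fun hy : w.1 = y.1 => y.2 (hy ▸ h _ w.2)]; rfl
  · apply Multiplicative.toAdd.injective
    ext y
    rw [key, toAdd_ofAdd, Finsupp.single_apply]
    simp [Subtype.ext_iff]

/-- The primes outside `primesAbove L Sᶜ` are exactly those over `S`, so these are `S`-units indexed
by the finite places over `S`. -/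
theorem exists_finite_family (S : Set (HeightOneSpectrum (𝓞 K)))  :
    ∃ ε : {w // w ∉ primesAbove L Sᶜ} → Lˣ,
      (∀ (σ : Gal(L/K)) w, galUnit K L σ (ε w) = ε (σ • w)) ∧
      (∀ w, ordUnit L (primesAbove L S) (ε w) = 1) ∧
      ∀ w, ∃ c : ℕ, c ≠ 0 ∧ ordUnit L (primesAbove L Sᶜ) (ε w) =
        Multiplicative.ofAdd (Finsupp.single w (c : ℤ)) := by
  choose u hu c hc hc' using fun w => exists_ordUnit_eq_single (L := L) (T := primesAbove L S)
    (T' := primesAbove L Sᶜ) (fun w hw => not_not.1 hw) w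
  obtain ⟨ε, h1, h2⟩ := exists_equivariant (G := Gal(L/K)) galUnit_mul u
  refine ⟨ε, h1, fun w => ?_, fun w => ?_⟩
  · obtain ⟨w₀, t, ht, htw, hε⟩ := h2 w
    rw [hε, map_prod]
    refine Finset.prod_eq_one fun g _ => ?_
    rw [galUnit, ordUnit_map, hu, map_one]
  · obtain ⟨w₀, t, ht, htw, hε⟩ := h2 w
    refine ⟨t.card * c w₀, mul_ne_zero ht.card_ne_zero (hc _), ?_⟩
    rw [hε, map_prod, Finset.prod_congr rfl (g := fun _ =>
      Multiplicative.ofAdd (Finsupp.single w (c w₀ : ℤ))), Finset.prod_const]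
    · rw [← ofAdd_nsmul, Finsupp.smul_single]
      simp
    · intro g hg
      rw [galUnit, ordUnit_map, hc', permHom_ofAdd, Finsupp.mapDomain_single, htw g hg]

end Units

/-! ### Adding a factor `ℤ` with trivial action. -/

section ProdInt

variable {A G : Type*} [CommGroup A] [Group G] [Fintype G] (ρ : G → A →* A)

/-- The action on `A × ℤ` which is trivial on the second factor. -/
def prodInt (g : G) : A × Multiplicative ℤ →* A × Multiplicative ℤ :=
  (ρ g).prodMap (MonoidHom.id _)

theorem map_prodMap_prod {A B A' B' : Type*} [Group A] [Group B] [Group A'] [Group B']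
    (f : A →* A') (g : B →* B') (H : Subgroup A) (K : Subgroup B) :
    (H.prod K).map (f.prodMap g) = (H.map f).prod (K.map g) := by
  ext ⟨x, y⟩
  constructor
  · rintro ⟨⟨a, b⟩, ⟨ha, hb⟩, h⟩
    exact ⟨⟨a, ha, congrArg Prod.fst h⟩, ⟨b, hb, congrArg Prod.snd h⟩⟩
  · rintro ⟨⟨a, ha, rfl⟩, ⟨b, hb, rfl⟩⟩
    exact ⟨(a, b), ⟨ha, hb⟩, rfl⟩

theorem prod_inf_prod {A B : Type*} [Group A] [Group B] (H H' : Subgroup A) (K K' : Subgroup B) :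
    H.prod K ⊓ H'.prod K' = (H ⊓ H').prod (K ⊓ K') := by
  ext x
  simp only [Subgroup.mem_inf, Subgroup.mem_prod]
  tauto

theorem diffHom_prodInt (s : G) : diffHom (prodInt ρ s) = (diffHom (ρ s)).prodMap 1 := by
  ext1 ⟨a, n⟩
  exact Prod.ext rfl (div_self' n)

theorem normHom_prodInt :
    normHom (prodInt ρ) = (normHom ρ).prodMap (powMonoidHom (Nat.card G)) := by
  ext1 ⟨a, n⟩
  rw [normHom_apply]
  refine Prod.ext ?_ ?_
  · rw [Prod.fst_prod]
    exact (normHom_apply ρ a).symm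
  · rw [Prod.snd_prod]
    change ∏ _g : G, n = n ^ Nat.card G
    rw [Finset.prod_const, Finset.card_univ, Nat.card_eq_fintype_card]

theorem index_powMonoidHom_int (n : ℕ) :
    (powMonoidHom n : Multiplicative ℤ →* Multiplicative ℤ).range.index = n := by
  have h := Int.index_zmultiples n
  rw [Int.natAbs_natCast, ← AddSubgroup.index_toSubgroup] at h
  refine Eq.trans (congrArg Subgroup.index ?_) h
  ext x
  constructor
  · rintro ⟨y, rfl⟩
    exact ⟨y.toAdd, by simp [mul_comm]⟩
  · rintro ⟨y, rfl⟩
    exact ⟨Multiplicative.ofAdd y, Multiplicative.toAdd.injective (mul_comm (n : ℤ) y)⟩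

/-- On `ℤ` with trivial action the norm is multiplication by `|G|`, of index `|G|`. -/
theorem relIndex_norm_prodInt (U : Subgroup A) (s : G) :
    ((U.prod ⊤).map (normHom (prodInt ρ))).relIndex (U.prod ⊤ ⊓ (diffHom (prodInt ρ s)).ker) =
      (U.map (normHom ρ)).relIndex (U ⊓ (diffHom (ρ s)).ker) * Nat.card G := by
  rw [normHom_prodInt, diffHom_prodInt, map_prodMap_prod, MonoidHom.ker_prodMap, prod_inf_prod,
    relIndex_prod, MonoidHom.ker_one, top_inf_eq, Subgroup.relIndex_top_right,
    ← MonoidHom.range_eq_map, index_powMonoidHom_int]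

/-- On `ℤ` the norm is injective, so this index gains no factor. -/
theorem relIndex_diff_prodInt (U : Subgroup A) (s : G) :
    ((U.prod ⊤).map (diffHom (prodInt ρ s))).relIndex (U.prod ⊤ ⊓ (normHom (prodInt ρ)).ker) =
      (U.map (diffHom (ρ s))).relIndex (U ⊓ (normHom ρ).ker) := by
  have h : (powMonoidHom (Nat.card G) : Multiplicative ℤ →* Multiplicative ℤ).ker = ⊥ := by
    rw [MonoidHom.ker_eq_bot_iff]
    intro a b hab
    have h1 : (Nat.card G : ℤ) * a.toAdd = Nat.card G * b.toAdd := by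
      have := congrArg Multiplicative.toAdd hab
      simpa using this
    have h2 : (Nat.card G : ℤ) ≠ 0 := Int.natCast_ne_zero.2 Nat.card_pos.ne'
    exact Multiplicative.toAdd.injective (mul_left_cancel₀ h2 h1)
  rw [normHom_prodInt, diffHom_prodInt, map_prodMap_prod, MonoidHom.ker_prodMap, prod_inf_prod,
    relIndex_prod, h, inf_bot_eq, Subgroup.relIndex_bot_right, mul_one]

end ProdInt

/-! ### The Herbrand quotient of the `S`-units. -/

section SUnits

variable {K : Type*} [Field K] [NumberField K] {L : Type*} [Field L] [NumberField L] [Algebra K L]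
  [IsGalois K L]

variable (L) in
/-- The map from the places of `L` to those of `K`, on the infinite places and on the finite places
over `S`. -/
def placeBelow (S : Set (HeightOneSpectrum (𝓞 K))) :
    InfinitePlace L ⊕ {w // w ∉ primesAbove L Sᶜ} → InfinitePlace K ⊕ {v // v ∉ Sᶜ} :=
  Sum.map (fun w => w.comap (algebraMap K L)) (primeBelow L Sᶜ)

theorem placeBelow_surjective (S : Set (HeightOneSpectrum (𝓞 K))) :
    Function.Surjective (placeBelow L S) :=
  Function.Surjective.sumMap InfinitePlace.comap_surjective (primeBelow_surjective Sᶜ)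

theorem placeBelow_eq_iff (S : Set (HeightOneSpectrum (𝓞 K)))
    (w w' : InfinitePlace L ⊕ {w // w ∉ primesAbove L Sᶜ}) :
    placeBelow L S w = placeBelow L S w' ↔ ∃ σ : Gal(L/K), σ • w = w' := by
  rcases w with w | w <;> rcases w' with w' | w'
  · simpa [placeBelow] using comap_eq_iff (K := K) w w'
  · simp [placeBelow]
  · simp [placeBelow]
  · simpa [placeBelow] using primeBelow_eq_iff Sᶜ w w'

theorem finite_primesAbove (S : Finset (HeightOneSpectrum (𝓞 K))) :
    Finite {w // w ∉ primesAbove L (S : Set (HeightOneSpectrum (𝓞 K)))ᶜ} := by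
  have : Finite {v // v ∉ (S : Set (HeightOneSpectrum (𝓞 K)))ᶜ} :=
    (S.finite_toSet.subset fun v hv => not_not.1 hv :
      Set.Finite {v | v ∉ (S : Set (HeightOneSpectrum (𝓞 K)))ᶜ})
  have h := finite_preimage_of_orbits (G := Gal(L/K))
    (primeBelow_eq_iff (L := L) (S : Set (HeightOneSpectrum (𝓞 K)))ᶜ) Set.finite_univ
  rw [Set.preimage_univ] at h
  exact Set.finite_univ_iff.1 h

/-- Filter by `f`, the valuations at the primes outside `T'`. On the image of `f` the family is
diagonal with nonzero entries `c w`; on the kernel only ordinary units remain, where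
`prodHom_unit_injective` and the unit rank apply. `relIndex_eq_map_mul_ker` joins the two finite
indices. -/
theorem permutation_sUnits {T T' : Set (HeightOneSpectrum (𝓞 L))} [Fintype {w // w ∉ T'}]
    (hT : ∀ w ∈ T', w ∉ T) {ε : InfinitePlace L → (𝓞 L)ˣ}
    (hε : ∀ w w' : InfinitePlace L, w' ≠ w → Real.log (w' (ε w : L)) < 0)
    {η : {w // w ∉ T'} → Lˣ} (hη : ∀ w, ordUnit L T (η w) = 1) {c : {w // w ∉ T'} → ℕ}
    (hc : ∀ w, c w ≠ 0)
    (hc' : ∀ w, ordUnit L T' (η w) = Multiplicative.ofAdd (Finsupp.single w (c w : ℤ))) :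
    letI E : InfinitePlace L ⊕ {w // w ∉ T'} → Lˣ × Multiplicative ℤ :=
      Sum.elim (fun w => (unitIncl L (ε w), Multiplicative.ofAdd 1)) fun w => (η w, 1)
    Function.Injective (prodHom E) ∧ (prodHom E).range ≤ (ordUnit L T).ker.prod ⊤ ∧
      (prodHom E).range.relIndex ((ordUnit L T).ker.prod ⊤) ≠ 0 := by
  classical
  have hunit : ∀ (T'' : Set (HeightOneSpectrum (𝓞 L))) (x : (𝓞 L)ˣ),
      ordUnit L T'' (unitIncl L x) = 1 := fun T'' x =>
    ordUnit_eq_one_iff.2 fun w _ => valuation_unitIncl x w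
  let E₀ : InfinitePlace L → (𝓞 L)ˣ × Multiplicative ℤ := fun w => (ε w, Multiplicative.ofAdd 1)
  let j : (𝓞 L)ˣ × Multiplicative ℤ →* Lˣ × Multiplicative ℤ :=
    (unitIncl L).prodMap (MonoidHom.id _)
  have hj : Function.Injective j := unitIncl_injective.prodMap Function.injective_id
  let E₁ : {w // w ∉ T'} → Lˣ × Multiplicative ℤ := fun w => (η w, 1)
  let E : InfinitePlace L ⊕ {w // w ∉ T'} → Lˣ × Multiplicative ℤ :=
    Sum.elim (fun w => j (E₀ w)) E₁
  let f : Lˣ × Multiplicative ℤ →* Multiplicative ({w // w ∉ T'} →₀ ℤ) :=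
    (ordUnit L T').comp (MonoidHom.fst _ _)
  have hfj : ∀ x, f (j x) = 1 := fun x => hunit T' x.1
  let δ : {w // w ∉ T'} → Multiplicative ({w // w ∉ T'} →₀ ℤ) :=
    fun w => Multiplicative.ofAdd (Finsupp.single w (c w : ℤ))
  have hδ : ∀ (a : Multiplicative ({w // w ∉ T'} →₀ ℤ)) w,
      (prodHom δ a).toAdd w = a.toAdd w * c w := by
    intro a w
    rw [prodHom_apply, toAdd_prod, Finsupp.finsetSum_apply, Finset.sum_eq_single w]
    · simp [δ]
    · intro w' _ h
      simp [δ, Finsupp.single_eq_of_ne h.symm]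
    · simp
  have hδinj : Function.Injective (prodHom δ) := by
    intro a b hab
    apply Multiplicative.toAdd.injective
    ext w
    have h := hδ a w
    rw [hab, hδ] at h
    exact (mul_right_cancel₀ (Int.natCast_ne_zero.2 (hc w)) h).symm
  have hle : (prodHom E).range ≤ (ordUnit L T).ker.prod ⊤ := by
    rw [range_prodHom, Subgroup.closure_le]
    rintro _ ⟨w | w, rfl⟩
    · exact ⟨hunit T _, trivial⟩
    · exact ⟨hη w, trivial⟩
  refine ⟨?_, hle, ?_⟩
  · change Function.Injective (prodHom E)
    rw [injective_iff_map_eq_one]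
    intro a ha
    let a₁ : Multiplicative (InfinitePlace L →₀ ℤ) :=
      Multiplicative.ofAdd (Finsupp.equivFunOnFinite.symm fun w => a.toAdd (Sum.inl w))
    let a₂ : Multiplicative ({w // w ∉ T'} →₀ ℤ) :=
      Multiplicative.ofAdd (Finsupp.equivFunOnFinite.symm fun w => a.toAdd (Sum.inr w))
    have hsplit : prodHom E a = j (prodHom E₀ a₁) * prodHom E₁ a₂ := by
      rw [map_prodHom, prodHom_apply, prodHom_apply, prodHom_apply, Fintype.prod_sum_type]
      rfl
    rw [hsplit] at ha
    have h2 : a₂ = 1 := by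
      apply hδinj
      have h := congrArg f ha
      rw [map_mul, hfj, one_mul, map_prodHom, map_one f] at h
      rw [map_one (prodHom δ), ← h]
      exact congrArg (fun d => prodHom d a₂) (funext fun w => (hc' w).symm)
    rw [h2, map_one (prodHom E₁), mul_one] at ha
    have h1 : a₁ = 1 := prodHom_unit_injective hε
      (hj (ha.trans ((congrArg j (map_one (prodHom E₀))).trans (map_one j)).symm))
    apply Multiplicative.toAdd.injective
    ext w
    rcases w with w | w
    · exact DFunLike.congr_fun (congrArg Multiplicative.toAdd h1) w
    · exact DFunLike.congr_fun (congrArg Multiplicative.toAdd h2) w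
  · change (prodHom E).range.relIndex ((ordUnit L T).ker.prod ⊤) ≠ 0
    rw [relIndex_eq_map_mul_ker f hle]
    refine mul_ne_zero ?_ ?_
    · have h1 : (prodHom δ).range ≤ (prodHom E).range.map f := by
        rw [range_prodHom, range_prodHom, Subgroup.closure_le]
        rintro _ ⟨w, rfl⟩
        exact ⟨E (Sum.inr w), Subgroup.subset_closure ⟨_, rfl⟩, hc' w⟩
      have h2 : (prodHom δ).range.index ≠ 0 :=
        index_range_ne_zero _ hδinj (AddEquiv.additiveMultiplicative _)
          (Module.finrank_finsupp_self ℤ)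
      rw [← Subgroup.relIndex_top_right] at h2
      exact fun h => h2 (Subgroup.relIndex_eq_zero_of_le_left h1
        (Subgroup.relIndex_eq_zero_of_le_right le_top h))
    · have h1 : (prodHom E₀).range.map j ≤ (prodHom E).range ⊓ f.ker := by
        refine le_inf ?_ ?_
        · rw [range_prodHom, range_prodHom, MonoidHom.map_closure]
          refine Subgroup.closure_mono ?_
          rintro _ ⟨_, ⟨w, rfl⟩, rfl⟩
          exact ⟨Sum.inl w, rfl⟩
        · rintro _ ⟨x, -, rfl⟩
          exact hfj x
      have h2 : (ordUnit L T).ker.prod ⊤ ⊓ f.ker ≤ (⊤ : Subgroup _).map j := by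
        rintro ⟨x, n⟩ ⟨⟨hx, -⟩, hx'⟩
        obtain ⟨y, hy⟩ : x ∈ (unitIncl L).range := by
          refine mem_range_unitIncl fun w => ?_
          by_cases hw : w ∈ T'
          · exact ordUnit_eq_one_iff.1 hx w (hT w hw)
          · exact ordUnit_eq_one_iff.1 hx' w hw
        exact ⟨(y, n), trivial, Prod.ext hy rfl⟩
      have h3 : ((prodHom E₀).range.map j).relIndex ((⊤ : Subgroup _).map j) ≠ 0 := by
        rw [Subgroup.relIndex_map_map_of_injective _ _ hj, Subgroup.relIndex_top_right]
        exact index_range_prodHom_unit_ne_zero hε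
      exact fun h => h3 (Subgroup.relIndex_eq_zero_of_le_left h1
        (Subgroup.relIndex_eq_zero_of_le_right h2 h))

theorem exists_permutation_sUnits (S : Set (HeightOneSpectrum (𝓞 K)))
    [Fintype {w // w ∉ primesAbove L Sᶜ}] :
    ∃ E : InfinitePlace L ⊕ {w // w ∉ primesAbove L Sᶜ} → Lˣ × Multiplicative ℤ,
      (∀ (σ : Gal(L/K)) w, prodInt (galUnit K L) σ (E w) = E (σ • w)) ∧
      Function.Injective (prodHom E) ∧
      (prodHom E).range ≤ (ordUnit L (primesAbove L S)).ker.prod ⊤ ∧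
      (prodHom E).range.relIndex ((ordUnit L (primesAbove L S)).ker.prod ⊤) ≠ 0 := by
  obtain ⟨ε, hε, hε'⟩ := exists_unit_family (K := K) (L := L)
  obtain ⟨η, hη, hη1, hη2⟩ := exists_finite_family (L := L) S
  choose c hc hc' using hη2
  refine ⟨_, ?_, permutation_sUnits (T := primesAbove L S)
    (T' := primesAbove L Sᶜ) (fun w hw => hw) hε' hη1 hc hc'⟩
  rintro σ (w | w)
  · exact Prod.ext (congrArg (unitIncl L) (hε σ w)) rfl
  · exact Prod.ext (hη σ w) rfl

theorem finprod_card_stabilizer (S : Finset (HeightOneSpectrum (𝓞 K))) :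
    ∏ᶠ v, Nat.card (MulAction.stabilizer Gal(L/K)
      (Function.surjInv (placeBelow_surjective (L := L) (S : Set (HeightOneSpectrum (𝓞 K)))) v)) =
      (∏ v ∈ S, localDegree L v) * ∏ v : InfinitePlace K, localDegreeInfinite L v := by
  classical
  have hπ := placeBelow_surjective (L := L) (S : Set (HeightOneSpectrum (𝓞 K)))
  have hG := placeBelow_eq_iff (L := L) (S : Set (HeightOneSpectrum (𝓞 K)))
  have hcard : ∀ w, Nat.card (MulAction.stabilizer Gal(L/K) (Function.surjInv hπ
      (placeBelow L (S : Set (HeightOneSpectrum (𝓞 K))) w))) =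
        Nat.card (MulAction.stabilizer Gal(L/K) w) :=
    fun w => (card_smul_eq hπ hG (w := w) (w' := w) rfl).symm
  let eS : {v // v ∉ (S : Set (HeightOneSpectrum (𝓞 K)))ᶜ} ≃ S :=
    Equiv.subtypeEquivRight fun v => by simp
  have := Fintype.ofEquiv _ eS.symm
  rw [finprod_eq_prod_of_fintype, Fintype.prod_sum_type, mul_comm, ← Finset.prod_coe_sort S,
    ← Equiv.prod_comp eS]
  refine congrArg₂ (· * ·) (Finset.prod_congr rfl fun v _ => ?_)
    (Finset.prod_congr rfl fun v _ => ?_)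
  · obtain ⟨w, hw, h⟩ := localDegree_eq_card_stabilizer (L := L) v.1
    have hw' : w ∉ primesAbove L (S : Set (HeightOneSpectrum (𝓞 K)))ᶜ := by
      intro h; exact v.2 (hw ▸ h)
    have hv : placeBelow L (S : Set (HeightOneSpectrum (𝓞 K))) (Sum.inr ⟨w, hw'⟩) = Sum.inr v :=
      congrArg Sum.inr (Subtype.ext hw)
    refine Eq.trans ?_ h.symm
    rw [← hv, hcard]
    refine congrArg (fun H : Subgroup Gal(L/K) => Nat.card H) ?_
    ext σ
    simp [MulAction.mem_stabilizer_iff, Subtype.ext_iff, coe_smul_notMem]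
  · obtain ⟨w, rfl, h⟩ := localDegreeInfinite_eq_card_stabilizer (L := L) v
    refine Eq.trans ?_ h.symm
    change Nat.card (MulAction.stabilizer Gal(L/K) (Function.surjInv hπ
      (placeBelow L (S : Set (HeightOneSpectrum (𝓞 K))) (Sum.inl w)))) = _
    rw [hcard]
    refine congrArg (fun H : Subgroup Gal(L/K) => Nat.card H) ?_
    ext σ
    simp [MulAction.mem_stabilizer_iff]

/-- `herbrand_of_permutation` is applied to `U × ℤ`; the factor `ℤ` accounts for `Nat.card
Gal(L/K)`. -/
theorem herbrand_sUnits (S : Finset (HeightOneSpectrum (𝓞 K))) {s : Gal(L/K)}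
    (hs : ∀ g, g ∈ Subgroup.zpowers s) {U : Subgroup Lˣ}
    (hU : U = (ordUnit L (primesAbove L (S : Set (HeightOneSpectrum (𝓞 K))))).ker) :
    (U.map (diffHom (galUnit K L s))).relIndex (U ⊓ (normHom (galUnit K L)).ker) ≠ 0 ∧
    (U.map (normHom (galUnit K L))).relIndex (U ⊓ (diffHom (galUnit K L s)).ker) *
        Nat.card Gal(L/K) =
      ((∏ v ∈ S, localDegree L v) * ∏ v : InfinitePlace K, localDegreeInfinite L v) *
        (U.map (diffHom (galUnit K L s))).relIndex (U ⊓ (normHom (galUnit K L)).ker) := by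
  have := finite_primesAbove (L := L) S
  have := Fintype.ofFinite {w // w ∉ primesAbove L (S : Set (HeightOneSpectrum (𝓞 K)))ᶜ}
  have : Finite {v // v ∉ (S : Set (HeightOneSpectrum (𝓞 K)))ᶜ} :=
    (S.finite_toSet.subset fun v hv => not_not.1 hv :
      Set.Finite {v | v ∉ (S : Set (HeightOneSpectrum (𝓞 K)))ᶜ})
  obtain ⟨E, h1, h2, h3, h4⟩ := exists_permutation_sUnits (L := L)
    (S : Set (HeightOneSpectrum (𝓞 K)))
  rw [← hU] at h3 h4
  have hW : ∀ (g : Gal(L/K)), ∀ a ∈ U.prod (⊤ : Subgroup (Multiplicative ℤ)),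
      prodInt (galUnit K L) g a ∈ U.prod (⊤ : Subgroup (Multiplicative ℤ)) := by
    rintro g ⟨x, n⟩ ⟨hx, -⟩
    refine ⟨?_, trivial⟩
    subst hU
    change ordUnit L _ (galUnit K L g x) = 1
    rw [galUnit, ordUnit_map, (MonoidHom.mem_ker).1 hx, map_one]
  have h5 := herbrand_of_permutation
    (placeBelow_surjective (L := L) (S : Set (HeightOneSpectrum (𝓞 K))))
    (placeBelow_eq_iff (L := L) (S : Set (HeightOneSpectrum (𝓞 K)))) hs
    (ρ := prodInt (galUnit K L)) (fun _ _ _ => rfl) h1 h2 hW h3 h4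
  rwa [relIndex_diff_prodInt, relIndex_norm_prodInt, finprod_card_stabilizer] at h5

end SUnits

/-! ### Orders of the ambiguous class groups as relative indices. -/

theorem card_map_mk' {Q : Type*} [Group Q] (P M : Subgroup Q) [P.Normal] :
    Nat.card (M.map (QuotientGroup.mk' P)) = P.relIndex M := by
  rw [← Subgroup.relIndex_bot_left, ← Subgroup.map_bot (QuotientGroup.mk' P),
    Subgroup.relIndex_map_map, QuotientGroup.ker_mk', bot_sup_eq, Subgroup.relIndex_sup_right]

theorem relIndex_comap_comap {A B : Type*} [Group A] [Group B] {f : A →* B}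
    (hf : Function.Surjective f) (H H' : Subgroup B) :
    (H.comap f).relIndex (H'.comap f) = H.relIndex H' := by
  rw [Subgroup.relIndex_comap, Subgroup.map_comap_eq_self_of_surjective hf]

section Classes

variable {K : Type*} [Field K] [NumberField K] {L : Type*} [Field L] [NumberField L] [Algebra K L]
  (S : Set (HeightOneSpectrum (𝓞 K)))

theorem ordEquiv_galSIdeal (σ : Gal(L/K)) (I : sIdeals L (primesAbove L S)) :
    ordEquiv L (primesAbove L S) (galSIdeal S σ I) =
      permHom σ (ordEquiv L (primesAbove L S) I) :=
  ordHom_galIdeal S σ I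

theorem invariantSIdeals_eq_comap {s : Gal(L/K)} (hs : ∀ g, g ∈ Subgroup.zpowers s) :
    invariantSIdeals L S = (diffHom (permHom s)).ker.comap
      (ordEquiv L (primesAbove L S)).toMonoidHom := by
  ext I
  rw [Subgroup.mem_comap]
  constructor
  · intro h
    rw [mem_ker_diffHom]
    exact (ordEquiv_galSIdeal S s I).symm.trans (congrArg _ (h s))
  · intro h σ
    apply (ordEquiv L (primesAbove L S)).injective
    rw [ordEquiv_galSIdeal]
    exact apply_eq_of_mem_ker_diffHom permHom_mul permHom_one hs h σ

theorem card_stronglyAmbiguous {s : Gal(L/K)} (hs : ∀ g, g ∈ Subgroup.zpowers s) :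
    Nat.card (stronglyAmbiguous L S) =
      (ordUnit L (primesAbove L S)).range.relIndex (diffHom (permHom s)).ker := by
  rw [stronglyAmbiguous, card_map_mk', invariantSIdeals_eq_comap S hs, principalSIdeals_eq_comap]
  exact relIndex_comap_comap (ordEquiv L (primesAbove L S)).surjective _ _

/-- The class of `I` is fixed by `σ` iff `(σ - 1) I` is principal, and it suffices to test the
generator. -/
theorem ambiguous_eq_map {s : Gal(L/K)} (hs : ∀ g, g ∈ Subgroup.zpowers s) :
    ambiguous L S = (((ordUnit L (primesAbove L S)).range.comap (diffHom (permHom s))).comap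
      (ordEquiv L (primesAbove L S)).toMonoidHom).map (QuotientGroup.mk' _) := by
  have key : ∀ (σ : Gal(L/K)) (I : sIdeals L (primesAbove L S)),
      galSClass S σ (QuotientGroup.mk' _ I) = QuotientGroup.mk' _ I ↔
        diffHom (permHom σ) (ordEquiv L (primesAbove L S) I) ∈
          (ordUnit L (primesAbove L S)).range := by
    intro σ I
    change (QuotientGroup.mk (galSIdeal S σ I) : SClass L (primesAbove L S)) =
      QuotientGroup.mk I ↔ _
    rw [eq_comm, QuotientGroup.eq, principalSIdeals_eq_comap, Subgroup.mem_comap, diffHom_apply,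
      ← ordEquiv_galSIdeal, div_eq_inv_mul, ← map_inv, ← map_mul]
    rfl
  have hP : ∀ (σ : Gal(L/K)), ∀ a ∈ (ordUnit L (primesAbove L S)).range,
      permHom σ a ∈ (ordUnit L (primesAbove L S)).range := by
    rintro σ _ ⟨x, rfl⟩
    exact ⟨_, ordUnit_map S σ x⟩
  ext c
  constructor
  · intro hc
    obtain ⟨I, rfl⟩ := QuotientGroup.mk'_surjective _ c
    exact ⟨I, (key s I).1 (hc s), rfl⟩
  · rintro ⟨I, hI, rfl⟩ σ
    rw [key]
    obtain ⟨k, rfl⟩ := (mem_powers_iff_mem_zpowers (x := s)).2 (hs σ)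
    set a := ordEquiv L (primesAbove L S) I
    replace hI : diffHom (permHom s) a ∈ (ordUnit L (primesAbove L S)).range := hI
    induction k with
    | zero =>
      change diffHom (permHom (s ^ 0)) a ∈ _
      rw [pow_zero, diffHom_apply, permHom_one, div_self']
      exact one_mem _
    | succ k ih =>
      -- This is `s ^ (k + 1) - 1 = s ^ k (s - 1) + (s ^ k - 1)`; principal ideals are stable under
      -- `s ^ k`.
      have h : diffHom (permHom (s ^ (k + 1))) a =
          permHom (s ^ k) (diffHom (permHom s) a) * diffHom (permHom (s ^ k)) a := by
        rw [diffHom_apply, diffHom_apply, diffHom_apply, map_div, ← permHom_mul, ← pow_succ,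
          div_mul_div_cancel]
      change diffHom (permHom (s ^ (k + 1))) a ∈ _
      rw [h]
      exact mul_mem (hP _ _ hI) ih

theorem card_ambiguous {s : Gal(L/K)} (hs : ∀ g, g ∈ Subgroup.zpowers s) :
    Nat.card (ambiguous L S) = (ordUnit L (primesAbove L S)).range.relIndex
      ((ordUnit L (primesAbove L S)).range.comap (diffHom (permHom s))) := by
  rw [ambiguous_eq_map S hs, card_map_mk', principalSIdeals_eq_comap]
  exact relIndex_comap_comap (ordEquiv L (primesAbove L S)).surjective _ _

end Classes

/-! ### Descent to `K`, Hilbert 90, and the contribution of ramification. -/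

section BaseField

variable {K : Type*} [Field K] [NumberField K] {L : Type*} [Field L] [NumberField L] [Algebra K L]
  [IsGalois K L] (S : Set (HeightOneSpectrum (𝓞 K)))

variable (K L) in
/-- The inclusion `Kˣ → Lˣ`. -/
def baseIncl : Kˣ →* Lˣ := Units.map (algebraMap K L).toMonoidHom

theorem baseIncl_injective : Function.Injective (baseIncl K L) :=
  Units.map_injective (algebraMap K L).injective

theorem baseIncl_normUnits (x : Lˣ) :
    baseIncl K L (normUnits K L x) = normHom (galUnit K L) x := by
  apply Units.ext
  rw [normHom_apply, Units.coe_prod]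
  exact Algebra.norm_eq_prod_automorphisms K (x : L)

theorem ker_diffHom_galUnit {s : Gal(L/K)} (hs : ∀ g, g ∈ Subgroup.zpowers s) :
    (diffHom (galUnit K L s)).ker = (baseIncl K L).range := by
  ext x
  constructor
  · intro hx
    have h : ∀ σ : Gal(L/K), σ (x : L) = x := fun σ => congrArg Units.val
      (apply_eq_of_mem_ker_diffHom (ρ := galUnit K L) galUnit_mul (fun _ => rfl) hs hx σ)
    obtain ⟨y, hy⟩ := (IsGalois.mem_range_algebraMap_iff_fixed (F := K) (x : L)).2 h
    have hy0 : y ≠ 0 := by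
      rintro rfl
      exact x.ne_zero (by rw [← hy, map_zero])
    exact ⟨Units.mk0 y hy0, Units.ext hy⟩
  · rintro ⟨y, rfl⟩
    rw [mem_ker_diffHom]
    exact Units.ext (s.commutes _)

/-- Hilbert's Theorem 90 for a cyclic extension. -/
theorem ker_normHom_galUnit {s : Gal(L/K)} (hs : ∀ g, g ∈ Subgroup.zpowers s) :
    (normHom (galUnit K L)).ker = (diffHom (galUnit K L s)).range := by
  classical
  ext x
  constructor
  · intro hx
    -- The cocycle sending `s ^ k` to `∏_{j < k} s ^ j x`. It does not depend on the exponent chosen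
    -- because `x` has norm `1`, which makes `p` periodic.
    let p : ℕ → Lˣ := fun k => ∏ j ∈ Finset.range k, galUnit K L (s ^ j) x
    have hadd : ∀ k l, p (k + l) = p k * galUnit K L (s ^ k) (p l) := by
      intro k l
      simp only [p, Finset.prod_range_add, map_prod, ← galUnit_mul, ← pow_add]
    have hp : p (orderOf s) = 1 := by
      rw [← MonoidHom.mem_ker.1 hx, normHom_apply, ← IsCyclic.image_range_orderOf hs,
        Finset.prod_image fun i hi j hj h => pow_injOn_Iio_orderOf
          (Finset.mem_range.1 hi) (Finset.mem_range.1 hj) h]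
    have hper : Function.Periodic p (orderOf s) := fun k => by
      rw [hadd, hp, map_one, mul_one]
    choose k hk using fun σ => (mem_powers_iff_mem_zpowers (x := s)).2 (hs σ)
    have hpk : ∀ l, p (k (s ^ l)) = p l := by
      intro l
      have h := pow_eq_pow_iff_modEq.1 (hk (s ^ l))
      rw [← hper.map_mod_nat, h, hper.map_mod_nat]
    obtain ⟨β, hβ⟩ := groupCohomology.isMulCoboundary₁_of_isMulCocycle₁_of_aut_to_units
      (fun σ : Gal(L/K) => p (k σ)) fun σ τ => by
        have h : σ * τ = s ^ (k σ + k τ) := by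
          rw [pow_add]
          exact congrArg₂ _ (hk σ).symm (hk τ).symm
        change p (k (σ * τ)) = galUnit K L σ (p (k τ)) * p (k σ)
        rw [h, hpk, hadd, mul_comm]
        exact congrArg (fun g => galUnit K L g (p (k τ)) * p (k σ)) (hk σ)
    refine ⟨β, (hβ s).trans ?_⟩
    have h := hpk 1
    rw [pow_one] at h
    exact h.trans (Finset.prod_range_one _)
  · rintro ⟨y, rfl⟩
    exact normHom_diffHom (ρ := galUnit K L) galUnit_mul s y

theorem ramificationIdxIn_ne_zero' (v : HeightOneSpectrum (𝓞 K)) :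
    v.asIdeal.ramificationIdxIn (𝓞 L) ≠ 0 := by
  obtain ⟨w, hw⟩ := exists_liesOver L v
  have hwv : w.under (𝓞 K) = v := HeightOneSpectrum.ext hw.over.symm
  subst hwv
  rw [ramificationIdxIn_eq]
  exact Ideal.IsDedekindDomain.ramificationIdx'_ne_zero_of_liesOver w.asIdeal
    (w.under (𝓞 K)).ne_bot

theorem ordUnit_baseIncl_eq_one_iff (x : Kˣ) :
    ordUnit L (primesAbove L S) (baseIncl K L x) = 1 ↔ ordUnit K S x = 1 := by
  rw [baseIncl, ordUnit_algebraMap]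
  exact map_eq_one_iff _ (inflate_injective (primeBelow_surjective S) (primeBelow_eq_iff S)
    fun v => ramificationIdxIn_ne_zero' v.1)

/-- That is, `U^G = U_K`: the fixed elements are `Kˣ`, and nonzero ramification indices make an
element of `K` an `S`-unit in both fields or in neither. -/
theorem map_baseIncl_ker {s : Gal(L/K)} (hs : ∀ g, g ∈ Subgroup.zpowers s) :
    (ordUnit K S).ker.map (baseIncl K L) =
      (ordUnit L (primesAbove L S)).ker ⊓ (diffHom (galUnit K L s)).ker := by
  rw [ker_diffHom_galUnit hs]
  ext x
  constructor
  · rintro ⟨y, hy, rfl⟩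
    exact ⟨(ordUnit_baseIncl_eq_one_iff S y).2 hy, y, rfl⟩
  · rintro ⟨hx, y, rfl⟩
    exact ⟨y, (ordUnit_baseIncl_eq_one_iff S y).1 hx, rfl⟩

theorem relIndex_norm_sUnits {s : Gal(L/K)} (hs : ∀ g, g ∈ Subgroup.zpowers s) :
    (((primesAbove L S).unit L).map (normUnits K L)).relIndex (S.unit K) =
      ((ordUnit L (primesAbove L S)).ker.map (normHom (galUnit K L))).relIndex
        ((ordUnit L (primesAbove L S)).ker ⊓ (diffHom (galUnit K L s)).ker) := by
  rw [← map_baseIncl_ker S hs, ← ker_ordUnit, ← ker_ordUnit,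
    ← Subgroup.relIndex_map_map_of_injective _ _ (baseIncl_injective (K := K) (L := L)),
    Subgroup.map_map]
  congr 2
  exact MonoidHom.ext baseIncl_normUnits

theorem relIndex_inf_range_norm {s : Gal(L/K)} (hs : ∀ g, g ∈ Subgroup.zpowers s) :
    (S.unit K ⊓ (normUnits K L).range).relIndex (S.unit K) =
      ((ordUnit L (primesAbove L S)).ker ⊓ (normHom (galUnit K L)).range).relIndex
        ((ordUnit L (primesAbove L S)).ker ⊓ (diffHom (galUnit K L s)).ker) := by
  rw [← map_baseIncl_ker S hs, ← ker_ordUnit,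
    ← Subgroup.relIndex_map_map_of_injective _ _ (baseIncl_injective (K := K) (L := L))]
  congr 1
  ext x
  constructor
  · rintro ⟨_, ⟨hy, z, rfl⟩, rfl⟩
    exact ⟨(ordUnit_baseIncl_eq_one_iff S _).2 hy, z, (baseIncl_normUnits z).symm⟩
  · rintro ⟨hx, z, rfl⟩
    rw [← baseIncl_normUnits] at hx ⊢
    exact ⟨_, ⟨(ordUnit_baseIncl_eq_one_iff S _).1 hx, z, rfl⟩, rfl⟩

/-- In the chain `val Kˣ ≤ J_K ≤ J_L^G` the first index is the class number of `K` and the second is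
the product of the ramification indices. -/
theorem relIndex_map_ordUnit_ker {s : Gal(L/K)} (hs : ∀ g, g ∈ Subgroup.zpowers s) :
    ((diffHom (galUnit K L s)).ker.map (ordUnit L (primesAbove L S))).relIndex
      (diffHom (permHom (Ω := {w // w ∉ primesAbove L S}) s)).ker =
      Nat.card (SClass K S) *
        ∏ᶠ (v : HeightOneSpectrum (𝓞 K)) (_ : v ∉ S), v.asIdeal.ramificationIdxIn (𝓞 L) := by
  have hG := primeBelow_eq_iff (L := L) S
  set e : {v // v ∉ S} → ℕ := fun v => v.1.asIdeal.ramificationIdxIn (𝓞 L)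
  have h1 : (diffHom (galUnit K L s)).ker.map (ordUnit L (primesAbove L S)) =
      (ordUnit K S).range.map (inflate hG e) := by
    rw [ker_diffHom_galUnit hs, ← MonoidHom.range_comp, ← MonoidHom.range_comp]
    exact congrArg MonoidHom.range (MonoidHom.ext (ordUnit_algebraMap S))
  have hfin : (Function.mulSupport e).Finite :=
    (finite_ramified (K := K) (L := L)).preimage Subtype.val_injective.injOn
  have h2 := relIndex_range_inflate (primeBelow_surjective S) hG hfin hs
  have h3 : (inflate hG e).range ≤ (diffHom (permHom s)).ker := fun f hf =>
    (mem_ker_diffHom_permHom hG hs).2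
      ((mem_range_inflate (primeBelow_surjective S) hG e).1 hf).1
  rw [h1, ← Subgroup.relIndex_mul_relIndex _ _ _ (Subgroup.map_le_range _ _) h3, h2, card_sClass,
    ← finprod_subtype_eq_finprod_cond (f := fun v : HeightOneSpectrum (𝓞 K) =>
      v.asIdeal.ramificationIdxIn (𝓞 L)) (fun v => v ∉ S), MonoidHom.range_eq_map (inflate hG e),
    Subgroup.relIndex_map_map_of_injective _ _ (inflate_injective (primeBelow_surjective S) hG
      fun v => ramificationIdxIn_ne_zero' v.1), Subgroup.relIndex_top_right]

end BaseField

/-! ### The two class number relations. -/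

section Formula

variable {K : Type*} [Field K] [NumberField K] {L : Type*} [Field L] [NumberField L] [Algebra K L]
  [IsGalois K L] (S : Set (HeightOneSpectrum (𝓞 K))) {s : Gal(L/K)}
  (hs : ∀ g, g ∈ Subgroup.zpowers s)

include hs

/-- The chain is `val Kˣ ≤ P ∩ J^G ≤ J^G`; the lower index is cohomology of the `S`-units, the upper
one is `|Am_st|`. -/
theorem card_stronglyAmbiguous_mul :
    ((ordUnit L (primesAbove L S)).ker.map (diffHom (galUnit K L s))).relIndex
        ((ordUnit L (primesAbove L S)).ker ⊓ (normHom (galUnit K L)).ker) *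
      Nat.card (stronglyAmbiguous L S) = Nat.card (SClass K S) *
        ∏ᶠ (v : HeightOneSpectrum (𝓞 K)) (_ : v ∉ S), v.asIdeal.ramificationIdxIn (𝓞 L) := by
  have hd := map_diffHom (ordUnit L (primesAbove L S)) (s := galUnit K L s) (ordUnit_map S s)
  rw [← relIndex_map_ordUnit_ker S hs, card_stronglyAmbiguous S hs,
    ← relIndex_map_ker_range_inf_ker _ _ _ _ hd (ker_normHom_galUnit hs),
    ← Subgroup.inf_relIndex_right (ordUnit L (primesAbove L S)).range]
  refine Subgroup.relIndex_mul_relIndex _ _ _ ?_ inf_le_right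
  rintro _ ⟨x, hx, rfl⟩
  refine ⟨⟨x, rfl⟩, ?_⟩
  change diffHom (permHom s) (ordUnit L (primesAbove L S) x) = 1
  rw [← hd, (MonoidHom.mem_ker).1 hx, map_one]

/-- The chain is `P ≤ P · J^G ≤ d⁻¹(P)`. -/
theorem card_ambiguous_eq_mul :
    Nat.card (ambiguous L S) = Nat.card (stronglyAmbiguous L S) *
      ((ordUnit L (primesAbove L S)).ker.map (normHom (galUnit K L))).relIndex
        ((ordUnit L (primesAbove L S)).ker ⊓ (normHom (galUnit K L)).range) := by
  have hd := map_diffHom (ordUnit L (primesAbove L S)) (s := galUnit K L s) (ordUnit_map S s)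
  have hn := map_normHom (ordUnit L (primesAbove L S)) (ρ := galUnit K L)
    (ordUnit_map (L := L) S)
  rw [card_ambiguous S hs, card_stronglyAmbiguous S hs, ← relIndex_sup_ker_comap_range _ _ _ _ _
    hd hn (ker_normHom_galUnit hs) (ker_normHom_permHom (primeBelow_surjective S)
      (primeBelow_eq_iff S) hs)]
  rw [← Subgroup.relIndex_sup_left (K := (ordUnit L (primesAbove L S)).range)
    (H := (diffHom (permHom s)).ker)]
  refine (Subgroup.relIndex_mul_relIndex _ _ _ le_sup_left (sup_le ?_ ?_)).symm
  · rintro _ ⟨x, rfl⟩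
    exact ⟨_, hd x⟩
  · intro a ha
    rw [Subgroup.mem_comap, (MonoidHom.mem_ker).1 ha]
    exact one_mem _

end Formula

end SClassGroup

end

/-! ### Assembly of the formula. -/

open SClassGroup

theorem mainTheorem7 {K L : Type*} [Field K] [NumberField K] [Field L] [NumberField L]
    [Algebra K L] [IsGalois K L] [IsCyclic Gal(L/K)]
    (S : Finset (HeightOneSpectrum (𝓞 K))) :
    Finite (ambiguous L (S : Set (HeightOneSpectrum (𝓞 K)))) ∧
    {v : HeightOneSpectrum (𝓞 K) | v.asIdeal.ramificationIdxIn (𝓞 L) ≠ 1}.Finite ∧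
    (Nat.card (ambiguous L (S : Set (HeightOneSpectrum (𝓞 K)))) : ℚ) =
      (Nat.card (SClass K (S : Set (HeightOneSpectrum (𝓞 K)))) * localFactor L S : ℚ) /
        (Module.finrank K L *
          ((S : Set (HeightOneSpectrum (𝓞 K))).unit K ⊓ (normUnits K L).range).relIndex
            ((S : Set (HeightOneSpectrum (𝓞 K))).unit K)) ∧
    (Nat.card (stronglyAmbiguous L (S : Set (HeightOneSpectrum (𝓞 K)))) : ℚ) =
      (Nat.card (SClass K (S : Set (HeightOneSpectrum (𝓞 K)))) * localFactor L S : ℚ) /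
        (Module.finrank K L *
          (((primesAbove L (S : Set (HeightOneSpectrum (𝓞 K)))).unit L).map
            (normUnits K L)).relIndex ((S : Set (HeightOneSpectrum (𝓞 K))).unit K)) := by
  obtain ⟨s, hs⟩ := IsCyclic.exists_generator (α := Gal(L/K))
  obtain ⟨hh1, hH⟩ := herbrand_sUnits S hs rfl
  have h1 := card_stronglyAmbiguous_mul (S : Set (HeightOneSpectrum (𝓞 K))) hs
  have h2 := card_ambiguous_eq_mul (S : Set (HeightOneSpectrum (𝓞 K))) hs
  have hq := relIndex_norm_sUnits (S : Set (HeightOneSpectrum (𝓞 K))) hs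
  have hp := relIndex_inf_range_norm (S : Set (HeightOneSpectrum (𝓞 K))) hs
  -- `[U_K : nU] = [U_K : U_K ∩ nX] · [U_K ∩ nX : nU]`, carried out inside `Lˣ`.
  have hqp := Subgroup.relIndex_mul_relIndex
    ((ordUnit L (primesAbove L (S : Set (HeightOneSpectrum (𝓞 K))))).ker.map
      (SClassGroup.normHom (galUnit K L)))
    ((ordUnit L (primesAbove L (S : Set (HeightOneSpectrum (𝓞 K))))).ker ⊓
      (SClassGroup.normHom (galUnit K L)).range)
    ((ordUnit L (primesAbove L (S : Set (HeightOneSpectrum (𝓞 K))))).ker ⊓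
      (diffHom (galUnit K L s)).ker) ?_ ?_
  · rw [← hp, ← hq] at hqp
    rw [← hq] at hH
    have hlf : localFactor L S = ((∏ v ∈ S, localDegree L v) *
      ∏ v : InfinitePlace K, localDegreeInfinite L v) *
        ∏ᶠ (v : HeightOneSpectrum (𝓞 K)) (_ : v ∉ (S : Set (HeightOneSpectrum (𝓞 K)))),
          v.asIdeal.ramificationIdxIn (𝓞 L) := rfl
    have hn : Nat.card Gal(L/K) = Module.finrank K L := IsGalois.card_aut_eq_finrank K L
    have hn0 : Module.finrank K L ≠ 0 := Module.finrank_pos.ne'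
    have hm0 : (∏ v ∈ S, localDegree L v) *
        ∏ v : InfinitePlace K, localDegreeInfinite L v ≠ 0 := by
      refine mul_ne_zero (Finset.prod_ne_zero_iff.2 fun v _ => ?_)
        (Finset.prod_ne_zero_iff.2 fun v _ => ?_)
      · obtain ⟨w, -, h⟩ := localDegree_eq_card_stabilizer (L := L) v
        rw [h]
        exact Nat.card_pos.ne'
      · obtain ⟨w, -, h⟩ := localDegreeInfinite_eq_card_stabilizer (L := L) v
        rw [h]
        exact Nat.card_pos.ne'
    have he0 : ∏ᶠ (v : HeightOneSpectrum (𝓞 K)) (_ : v ∉ (S : Set (HeightOneSpectrum (𝓞 K)))),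
          v.asIdeal.ramificationIdxIn (𝓞 L) ≠ 0 :=
      finprod_induction (· ≠ 0) one_ne_zero (fun _ _ => mul_ne_zero) fun v =>
        finprod_induction (· ≠ 0) one_ne_zero (fun _ _ => mul_ne_zero) fun _ =>
          ramificationIdxIn_ne_zero' v
    have hcl0 : Nat.card (SClass K (S : Set (HeightOneSpectrum (𝓞 K)))) ≠ 0 := by
      rw [card_sClass]
      exact index_range_ordUnit_ne_zero K _
    rw [hn] at hH
    rw [hlf]
    generalize ∏ᶠ (v : HeightOneSpectrum (𝓞 K)) (_ : v ∉ (S : Set (HeightOneSpectrum (𝓞 K)))),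
      v.asIdeal.ramificationIdxIn (𝓞 L) = e at h1 he0 ⊢
    -- Finiteness comes from nonvanishing: each relation has a nonzero side, so all its factors are
    -- nonzero, and a nonzero `Nat.card` means a finite group.
    have hst0 : Nat.card (stronglyAmbiguous L (S : Set (HeightOneSpectrum (𝓞 K)))) ≠ 0 :=
      right_ne_zero_of_mul (h1.trans_ne (mul_ne_zero hcl0 he0))
    have hq0 := left_ne_zero_of_mul (hH.trans_ne (mul_ne_zero hm0 hh1))
    have hr0 := left_ne_zero_of_mul (hqp.trans_ne hq0)
    have hp0 := right_ne_zero_of_mul (hqp.trans_ne hq0)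
    have ham0 : Nat.card (ambiguous L (S : Set (HeightOneSpectrum (𝓞 K)))) ≠ 0 :=
      h2.trans_ne (mul_ne_zero hst0 hr0)
    refine ⟨Nat.finite_of_card_ne_zero ham0, finite_ramified, ?_, ?_⟩
    · rw [eq_div_iff (by exact_mod_cast mul_ne_zero hn0 hp0)]
      norm_cast
      -- The auxiliary index `h₁` is nonzero and cancels between the class relation `h1` and the
      -- Herbrand relation `hH`.
      apply Nat.eq_of_mul_eq_mul_left (Nat.pos_of_ne_zero hh1)
      rw [h2]
      refine Eq.trans ?_ (congrArg₂ (· * ·) h1 (hqp ▸ hH) |>.trans ?_) <;> ring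
    · rw [eq_div_iff (by exact_mod_cast mul_ne_zero hn0 hq0)]
      norm_cast
      apply Nat.eq_of_mul_eq_mul_left (Nat.pos_of_ne_zero hh1)
      refine Eq.trans ?_ (congrArg₂ (· * ·) h1 hH |>.trans ?_) <;> ring
  · rintro _ ⟨x, hx, rfl⟩
    refine ⟨?_, x, rfl⟩
    change ordUnit L _ (SClassGroup.normHom (galUnit K L) x) = 1
    rw [map_normHom (ordUnit L _) (ρ := galUnit K L) (ordUnit_map (L := L) _),
      (MonoidHom.mem_ker).1 hx, map_one]
  · refine inf_le_inf_left _ ?_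
    rintro _ ⟨x, rfl⟩
    exact diffHom_normHom (ρ := galUnit K L) galUnit_mul s x
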